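/- **Setting.** Fix $p\in\mathbb N$, $\xi\in[0,2)$, $M\in\mathbb R$, a compact convex set $\Gamma\subset\mathbb R^p$, and a true parameter $\theta_0=(\mu_0^\dagger,\gamma_0)$ in the interior of $[-M,M]\times\Gamma$. Let $\nu$ be a probability law on $\mathbb R^p$ which is bounded (there is $c$ with $|z_k|\le c$ for all $k$, for $\nu$-a.e. $z$), centered ($\int z_k\,d\nu=0$ for all $k$), and whose covariance matrix $\int zz^T\,d\nu$ is strictly positive definite. For each $n$ we observe a simple undirected random graph on $n$ nodes with edge indicators $A_{ij}\in\{0,1\}$, $i<j$, and covariates $Z_{ij}\in\mathbb R^p$, $i<j$. The $Z_{ij}$ are i.i.d. with law $\nu$; conditionally on all the covariates, the $A_{ij}$ are independent with $$P(A_{ij}=1\mid Z)=\frac{\exp(\mu_0+\gamma_0^TZ_{ij})}{1+\exp(\mu_0+\gamma_0^TZ_{ij})},\qquad \mu_0=-\xi\log n+\mu_0^\dagger .$$ Let $\hat\theta=(\hat\mu^\dagger,\hat\gamma)$ be a (measurable) maximum likelihood estimator, i.e. almost surely a minimizer over $(\mu^\dagger,\gamma)\in[-M,M]\times\Gamma$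 of $$\mathcal L^\dagger(\mu^\dagger,\gamma)=-\Big(\sum_{i<j}A_{ij}\Big)\mu^\dagger-\sum_{i<j}(\gamma^TZ_{ij})A_{ij}+\sum_{i<j}\log\!\big(1+n^{-\xi}\exp(\mu^\dagger+\gamma^TZ_{ij})\big),$$ and put $\hat\mu=-\xi\log n+\hat\mu^\dagger$, the estimator of the global density parameter before reparametrization. Let $D\in\mathbb R^{\binom n2\times(p+1)}$ be the matrix with rows $(1,Z_{ij}^T)$, $i<j$, and define the plug-in Hessian $$\hat\Sigma=\frac1{\binom n2}D^T\operatorname{diag}\!\left(\frac{\exp(\hat\mu+\hat\gamma^TZ_{ij})}{(1+\exp(\hat\mu+\hat\gamma^TZ_{ij}))^2},\ i<j\right)D ,$$ which depends only on the covariates and on $(\hat\mu,\hat\gamma)$; $\xi$ does not enter otherwise. **Statement.** As $n\to\infty$, $\hat\Sigma$ is positive definite with probability tending to $1$, and for every $k=1,\dots,p$ $$\sqrt{\tbinom n2}\;\frac{\hat\gamma_k-\gamma_{0,k}}{\sqrt{(\hat\Sigma^{-1})_{k+1,k+1}}}\ \xrightarrow{\ d\ }\ \mathcal N(0,1)$$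 (the quotient may be given the value $0$ when $\hat\Sigma$ is singular). Consequently the intervals built from $\hat\gamma$ and $\hat\Sigma$ are asymptotically valid: for every $q\ge0$, $$P\Big(|\hat\gamma_k-\gamma_{0,k}|\le q\sqrt{(\hat\Sigma^{-1})_{k+1,k+1}/\tbinom n2}\Big)\longrightarrow \mathcal N(0,1)\big([-q,q]\big).$$ -/

import Mathlib

open MeasureTheory ProbabilityTheory Filter Topology
open scoped Matrix

noncomputable section

namespace ERC

/-- The node pairs `i < j` of a network on `n` nodes. -/
abbrev Pair (n : ℕ) : Type := {e : Fin n × Fin n // e.1 < e.2}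

/-- The logistic link probability `exp (μ + γᵀz) / (1 + exp (μ + γᵀz))`. -/
def linkProb {p : ℕ} (μ : ℝ) (γ z : Fin p → ℝ) : ℝ :=
  Real.exp (μ + γ ⬝ᵥ z) / (1 + Real.exp (μ + γ ⬝ᵥ z))

/-- The global density parameter `μ = -ξ log n + μ†`. -/
def globalParam (n : ℕ) (ξ μd : ℝ) : ℝ := -ξ * Real.log n + μd

/-- The Erdős–Rényi model with covariates on `n` nodes. The covariates `Z e`, `e = (i, j)`, `i < j`,
are i.i.d. with law `ν`; `A e` tells whether the edge `e` is present (a simple undirected graph is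
identified with the part of its adjacency matrix above the diagonal). Conditionally on all
covariates, the edges are independent, and the edge `e` is present with probability
`linkProb μ γ (Z e)`. -/
structure IsModel {p n : ℕ} {Ω : Type*} [MeasurableSpace Ω] (P : Measure Ω)
    (ν : Measure (Fin p → ℝ)) (μ : ℝ) (γ : Fin p → ℝ)
    (Z : Pair n → Ω → (Fin p → ℝ)) (A : Pair n → Ω → Bool) : Prop where
  measurable_Z : ∀ e, Measurable (Z e)
  measurable_A : ∀ e, Measurable (A e)
  indep_Z : iIndepFun Z P
  law_Z : ∀ e, P.map (Z e) = ν
  condProb_A : ∀ a : Pair n → Bool,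
    P⟦{ω | ∀ e, A e ω = a e} | MeasurableSpace.comap (fun ω e => Z e ω) inferInstance⟧
      =ᵐ[P] fun ω => ∏ e, if a e then linkProb μ γ (Z e ω) else 1 - linkProb μ γ (Z e ω)

/-- The negative log-likelihood `𝓛†(μ†, γ)` (up to a summand free of the parameter) at the
covariates `z` and the edge indicators `a`; `θ = (μ†, γ)`. -/
def negLogLik {p n : ℕ} (ξ : ℝ) (z : Pair n → (Fin p → ℝ)) (a : Pair n → Bool)
    (θ : ℝ × (Fin p → ℝ)) : ℝ :=
  -(∑ e, if a e then (1 : ℝ) else 0) * θ.1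
    - ∑ e, (θ.2 ⬝ᵥ z e) * (if a e then (1 : ℝ) else 0)
    + ∑ e, Real.log (1 + (n : ℝ) ^ (-ξ) * Real.exp (θ.1 + θ.2 ⬝ᵥ z e))

/-- The parameter space `[-M, M] × Γ`. -/
def paramSpace {p : ℕ} (M : ℝ) (Γ : Set (Fin p → ℝ)) : Set (ℝ × (Fin p → ℝ)) :=
  Set.Icc (-M) M ×ˢ Γ

/-- The design matrix `D = [1 | Z]`, with rows indexed by the pairs `i < j`. -/
def design {p n : ℕ} (z : Pair n → (Fin p → ℝ)) : Matrix (Pair n) (Fin (p + 1)) ℝ :=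
  Matrix.of fun e => Fin.cons 1 (z e)

/-- The plug-in Hessian `Σ̂ = (n choose 2)⁻¹ Dᵀ diag (e^x / (1 + e^x)²) D`, with
`x = μ + γᵀz e`. It is a function of the covariates and of `(μ, γ)` alone. -/
def plugInHessian {p n : ℕ} (z : Pair n → (Fin p → ℝ)) (μ : ℝ) (γ : Fin p → ℝ) :
    Matrix (Fin (p + 1)) (Fin (p + 1)) ℝ :=
  ((n.choose 2 : ℕ) : ℝ)⁻¹ •
    ((design z)ᵀ *
      Matrix.diagonal (fun e => Real.exp (μ + γ ⬝ᵥ z e) / (1 + Real.exp (μ + γ ⬝ᵥ z e)) ^ 2) *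
      design z)

end ERC

end

namespace ERC

/-! Write `ε = n^(-ξ)`, `N = n.choose 2`, `x e = (1, Z e)`. The model is logistic regression with
density factor `ε`, and its effective sample size is `τ = εN`, which tends to infinity because `ξ <
2`. On the compact parameter space all linear predictors are bounded, so every logistic variance has
exact order `ε`.

Two random events carry the probability. The Gram matrix `∑ x e (x e)ᵀ` dominates `lN`, by Chebyshev
and nondegeneracy of the second moment of `(1, z)` (`exists_measure_gram_lt_le`). The score `S` at
the truth is conditionally centred with second moment `O(τ)`, so `‖S‖² ≤ η τ^(3/2)` with probability
tending to one for every `η > 0` (`IsModel.measure_norm_score_sq_ge_le`).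

On these events the rest is deterministic. Strong convexity gives `‖δ‖ ≲ ‖S‖ / τ` for the error `δ`
of the minimizer (`norm_sub_le_of_logisticLoss_le`), hence `√τ ‖δ‖² ≲ η`. The minimizer is then
interior and its score vanishes. Expanding the score shows that the studentized error differs from
the normalised score `U = ∑ (A e - p e) c e` by `O(√τ ‖δ‖²)`; both the Taylor remainder and the
plug-in standard error cost this much (`abs_studentized_sub_le`, `studentized_close`).

Given the covariates, `U` is a sum of independent centred variables with total variance one and
coefficients `O(τ^(-1/2))`. Its conditional characteristic function is a product, which is compared
factor by factor with the Gaussian one (`norm_prod_bernoulliCharFun_sub_le`,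
`IsModel.norm_integral_exp_sub_le`). Lévy's continuity theorem gives normality, and the portmanteau
theorem gives coverage. -/

/-- The logistic probability `ε e^η / (1 + ε e^η)` with density factor `ε`. -/
noncomputable def logisticProb (ε η : ℝ) : ℝ := ε * Real.exp η / (1 + ε * Real.exp η)

/-- The logistic variance `ε e^η / (1 + ε e^η)²`. -/
noncomputable def logisticVar (ε η : ℝ) : ℝ := ε * Real.exp η / (1 + ε * Real.exp η) ^ 2

/-! ### Calculus of the logistic function with a density factor. -/

section Logistic

variable {ε : ℝ}

lemma logisticVar_pos (hε : 0 < ε) (η : ℝ) : 0 < logisticVar ε η := by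
  unfold logisticVar; positivity

lemma logisticProb_pos (hε : 0 < ε) (η : ℝ) : 0 < logisticProb ε η := by
  unfold logisticProb; positivity

lemma logisticProb_lt_one (hε : 0 < ε) (η : ℝ) : logisticProb ε η < 1 := by
  unfold logisticProb
  have := Real.exp_pos η
  rw [div_lt_one (by positivity)]
  linarith

lemma logisticProb_mul_one_sub (hε : 0 < ε) (η : ℝ) :
    logisticProb ε η * (1 - logisticProb ε η) = logisticVar ε η := by
  unfold logisticProb logisticVar
  have : 1 + ε * Real.exp η ≠ 0 := by positivity
  field_simp
  ring

lemma hasDerivAt_log_one_add_mul_exp (hε : 0 < ε) (η : ℝ) :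
    HasDerivAt (fun s => Real.log (1 + ε * Real.exp s)) (logisticProb ε η) η := by
  have h : 1 + ε * Real.exp η ≠ 0 := by positivity
  exact ((((Real.hasDerivAt_exp η).const_mul ε).const_add 1).log h)

lemma hasDerivAt_logisticProb (hε : 0 < ε) (η : ℝ) :
    HasDerivAt (logisticProb ε) (logisticVar ε η) η := by
  have h : 1 + ε * Real.exp η ≠ 0 := by positivity
  have h1 := (Real.hasDerivAt_exp η).const_mul ε
  refine (h1.div (h1.const_add 1) h).congr_deriv ?_
  unfold logisticVar
  congr 1
  ring

/-- The logarithm of the variance has derivative `1 - 2 * logisticProb`, of modulus at most one.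
Such a relative bound is free of `ε`, so it survives the sparse regime. -/
lemma logisticVar_le_exp_abs_mul (hε : 0 < ε) (η η' : ℝ) :
    logisticVar ε η' ≤ Real.exp |η' - η| * logisticVar ε η := by
  unfold logisticVar
  have hy : 0 < ε * Real.exp η := by positivity
  rcases le_total η η' with h | h
  · rw [abs_of_nonneg (by linarith), ← mul_div_assoc,
      show Real.exp (η' - η) * (ε * Real.exp η) = ε * (Real.exp (η' - η) * Real.exp η) by ring,
      ← Real.exp_add, sub_add_cancel]
    gcongr
  · obtain ⟨s, hs⟩ : ∃ s, s = Real.exp (η' - η) := ⟨_, rfl⟩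
    have hs0 : 0 < s := hs ▸ Real.exp_pos _
    have hs1 : s ≤ 1 := hs ▸ Real.exp_le_one_iff.2 (by linarith)
    have e1 : Real.exp |η' - η| = s⁻¹ := by
      rw [abs_of_nonpos (by linarith), Real.exp_neg, hs]
    have e2 : Real.exp η' = s * Real.exp η := by
      rw [hs, ← Real.exp_add, sub_add_cancel]
    rw [e1, e2, show ε * (s * Real.exp η) = s * (ε * Real.exp η) by ring]
    set y := ε * Real.exp η
    have key : s * (1 + y) ≤ 1 + s * y := by nlinarith
    have key2 : (s * (1 + y)) ^ 2 ≤ (1 + s * y) ^ 2 := by gcongr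
    rw [← mul_div_assoc, div_le_div_iff₀ (by positivity) (by positivity)]
    have : s⁻¹ * y * (1 + s * y) ^ 2 ≥ s⁻¹ * y * (s * (1 + y)) ^ 2 := by gcongr
    have e3 : s⁻¹ * y * (s * (1 + y)) ^ 2 = s * y * (1 + y) ^ 2 := by field_simp
    linarith

lemma logisticVar_le (hε : 0 < ε) {B η : ℝ} (h : |η| ≤ B) :
    logisticVar ε η ≤ Real.exp B * ε := by
  unfold logisticVar
  have h1 : Real.exp η ≤ Real.exp B := Real.exp_le_exp.2 (le_of_abs_le h)
  calc _ ≤ ε * Real.exp η / 1 := by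
        gcongr
        exact one_le_pow₀ (by have : 0 < ε * Real.exp η := by positivity
                              linarith)
    _ ≤ _ := by rw [div_one, mul_comm]; gcongr

lemma le_logisticVar (hε : 0 < ε) (hε1 : ε ≤ 1) {B η : ℝ} (h : |η| ≤ B) :
    Real.exp (-B) / (1 + Real.exp B) ^ 2 * ε ≤ logisticVar ε η := by
  unfold logisticVar
  have h1 : Real.exp η ≤ Real.exp B := Real.exp_le_exp.2 (le_of_abs_le h)
  have h2 : Real.exp (-B) ≤ Real.exp η := Real.exp_le_exp.2 (neg_le_of_abs_le h)
  rw [div_mul_eq_mul_div, mul_comm (Real.exp (-B))]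
  have : ε * Real.exp η ≤ Real.exp B := by
    calc _ ≤ 1 * Real.exp B := by gcongr
      _ = _ := one_mul _
  gcongr

/-- By `le_logisticVar` the function stays convex on `[-B, B]` after subtracting `m / 2 * s ^ 2`;
the claim compares a chord slope with the tangent of the difference. -/
lemma log_one_add_mul_exp_strong_convex (hε : 0 < ε) (hε1 : ε ≤ 1) {B η η' : ℝ}
    (h : |η| ≤ B) (h' : |η'| ≤ B) :
    Real.exp (-B) / (1 + Real.exp B) ^ 2 * ε / 2 * (η' - η) ^ 2 ≤
      Real.log (1 + ε * Real.exp η') - Real.log (1 + ε * Real.exp η)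
        - logisticProb ε η * (η' - η) := by
  set m := Real.exp (-B) / (1 + Real.exp B) ^ 2 * ε with hm
  have hd : ∀ s, HasDerivAt (fun s => Real.log (1 + ε * Real.exp s) - m / 2 * s ^ 2)
      (logisticProb ε s - m * s) s := fun s => by
    refine ((hasDerivAt_log_one_add_mul_exp hε s).sub
      (((hasDerivAt_id s).pow 2).const_mul (m / 2))).congr_deriv ?_
    simp; ring
  have hd2 : ∀ s, HasDerivAt (fun s => logisticProb ε s - m * s) (logisticVar ε s - m) s :=
    fun s => by
    refine ((hasDerivAt_logisticProb hε s).sub ((hasDerivAt_id s).const_mul m)).congr_deriv ?_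
    simp
  have hconv : ConvexOn ℝ (Set.Icc (-B) B)
      (fun s => Real.log (1 + ε * Real.exp s) - m / 2 * s ^ 2) := by
    refine convexOn_of_hasDerivWithinAt2_nonneg (convex_Icc _ _)
      (fun s _ => (hd s).continuousAt.continuousWithinAt)
      (fun s _ => (hd s).hasDerivWithinAt) (fun s _ => (hd2 s).hasDerivWithinAt) ?_
    intro s hs
    have hs' := interior_subset hs
    have := le_logisticVar hε hε1 (abs_le.2 ⟨hs'.1, hs'.2⟩)
    linarith
  have hη := abs_le.1 h
  have hη' := abs_le.1 h'
  rcases lt_trichotomy η η' with hlt | heq | hgt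
  · have := hconv.le_slope_of_hasDerivAt ⟨hη.1, hη.2⟩ ⟨hη'.1, hη'.2⟩ hlt (hd η)
    rw [slope_def_field, le_div_iff₀ (by linarith)] at this
    linarith
  · subst heq; simp
  · have := hconv.slope_le_of_hasDerivAt ⟨hη'.1, hη'.2⟩ ⟨hη.1, hη.2⟩ hgt (hd η)
    rw [slope_def_field, div_le_iff₀ (by linarith)] at this
    linarith

/-- Mean value inequality for `logisticProb - logisticVar ε η * id`, whose derivative is controlled
by `logisticVar_le_exp_abs_mul`. The remainder keeps the factor `logisticVar ε η`, hence the order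
`ε`. -/
lemma abs_logisticProb_sub_sub_le (hε : 0 < ε) (η η' : ℝ) :
    |logisticProb ε η' - logisticProb ε η - logisticVar ε η * (η' - η)| ≤
      |η' - η| ^ 2 * Real.exp |η' - η| * logisticVar ε η := by
  set r := |η' - η| with hr
  have hw := logisticVar_pos hε η
  have hbound : ∀ s ∈ Set.uIcc η η', ‖logisticVar ε s - logisticVar ε η‖ ≤
      r * Real.exp r * logisticVar ε η := by
    intro s hs
    have hsr : |s - η| ≤ r := Set.abs_sub_left_of_mem_uIcc hs
    have h1 := logisticVar_le_exp_abs_mul hε η s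
    have h2 := logisticVar_le_exp_abs_mul hε s η
    rw [abs_sub_comm] at h2
    have h3 : Real.exp |s - η| ≤ Real.exp r := Real.exp_le_exp.2 hsr
    have hws := logisticVar_pos hε s
    -- This is `1 - r ≤ e^(-r)` multiplied by `e^r`.
    have h4 : Real.exp r - 1 ≤ r * Real.exp r := by
      have := Real.add_one_le_exp (-r)
      rw [Real.exp_neg] at this
      have hp := Real.exp_pos r
      have : (-r + 1) * Real.exp r ≤ (Real.exp r)⁻¹ * Real.exp r := by gcongr
      rw [inv_mul_cancel₀ hp.ne'] at this
      linarith
    rw [Real.norm_eq_abs, abs_le]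
    have h5 : logisticVar ε s ≤ Real.exp r * logisticVar ε η := h1.trans (by gcongr)
    have h6 : logisticVar ε η ≤ Real.exp r * logisticVar ε s := h2.trans (by gcongr)
    constructor
    · rcases le_total (logisticVar ε η) (logisticVar ε s) with h7 | h7
      · have : 0 ≤ r * Real.exp r * logisticVar ε η := by positivity
        linarith
      · nlinarith [mul_nonneg (sub_nonneg.2 h4) hw.le, Real.one_le_exp (abs_nonneg (η' - η))]
    · nlinarith
  have := (convex_uIcc η η').norm_image_sub_le_of_norm_hasDerivWithin_le
    (f := fun s => logisticProb ε s - logisticVar ε η * s)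
    (f' := fun s => logisticVar ε s - logisticVar ε η)
    (fun s _ => (((hasDerivAt_logisticProb hε s).sub
      ((hasDerivAt_id s).const_mul (logisticVar ε η))).congr_deriv
        (by simp)).hasDerivWithinAt) hbound Set.left_mem_uIcc Set.right_mem_uIcc
  rw [Real.norm_eq_abs, Real.norm_eq_abs] at this
  calc _ = |logisticProb ε η' - logisticVar ε η * η' -
        (logisticProb ε η - logisticVar ε η * η)| := by congr 1; ring
    _ ≤ _ := this
    _ = _ := by rw [← hr]; ring

end Logistic

/-- The norm on `Fin d → ℝ` is the sup norm, hence the factor `d`. -/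
lemma abs_dotProduct_le {d : ℕ} (x u : Fin d → ℝ) : |x ⬝ᵥ u| ≤ d * (‖x‖ * ‖u‖) := by
  calc |x ⬝ᵥ u| ≤ ∑ j, |x j * u j| := Finset.abs_sum_le_sum_abs _ _
    _ ≤ ∑ _j : Fin d, ‖x‖ * ‖u‖ := by
        gcongr with j
        rw [abs_mul]
        exact mul_le_mul (norm_le_pi_norm x j) (norm_le_pi_norm u j) (abs_nonneg _) (norm_nonneg _)
    _ = _ := by simp

/-! ### Diagonal entries of inverse matrices. -/

section Inverse

variable {m : Type*} [Fintype m] [DecidableEq m]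

lemma mulVec_inv_mulVec_single {H : Matrix m m ℝ} (hH : H.PosDef) (k : m) :
    H *ᵥ (H⁻¹ *ᵥ Pi.single k 1) = Pi.single k 1 := by
  have := hH.isUnit
  rw [Matrix.mulVec_mulVec, Matrix.mul_nonsing_inv _ ((Matrix.isUnit_iff_isUnit_det _).1 this),
    Matrix.one_mulVec]

lemma inv_apply_pos {H : Matrix m m ℝ} (hH : H.PosDef) (k : m) : 0 < H⁻¹ k k :=
  hH.inv.diag_pos

lemma inv_mulVec_single_dotProduct {H : Matrix m m ℝ} (hH : H.PosDef) (k : m) :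
    (H⁻¹ *ᵥ Pi.single k 1) ⬝ᵥ (H *ᵥ (H⁻¹ *ᵥ Pi.single k 1)) = H⁻¹ k k := by
  rw [mulVec_inv_mulVec_single hH]
  simp

/-- The diagonal of the inverse is antitone in the quadratic form. -/
lemma inv_apply_le_mul {H H' : Matrix m m ℝ} (hH : H.PosDef) (hH' : H'.PosDef) {r : ℝ}
    (hr : 0 < r) (h : ∀ u, u ⬝ᵥ (H *ᵥ u) ≤ r * (u ⬝ᵥ (H' *ᵥ u))) (k : m) :
    H'⁻¹ k k ≤ r * H⁻¹ k k := by
  set v := H⁻¹ *ᵥ Pi.single k 1 with hv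
  set u := H'⁻¹ *ᵥ Pi.single k 1 with hu
  -- Here `v = H⁻¹ e_k` and `u = H'⁻¹ e_k`. Both cross terms of the expanded square equal `uᵀ e_k =
  -- H'⁻¹ k k`, and `uᵀ H u ≤ r * H'⁻¹ k k` by hypothesis.
  have h1 : 0 ≤ (v - r⁻¹ • u) ⬝ᵥ (H *ᵥ (v - r⁻¹ • u)) := by
    have := hH.posSemidef.dotProduct_mulVec_nonneg (v - r⁻¹ • u)
    simpa using this
  have hsymm : v ⬝ᵥ (H *ᵥ u) = u ⬝ᵥ (H *ᵥ v) := by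
    have hT : Hᵀ = H := by simpa using hH.isHermitian.eq
    conv_lhs => rw [Matrix.dotProduct_mulVec, ← Matrix.mulVec_transpose, hT]
    exact dotProduct_comm _ _
  have huv : u ⬝ᵥ (H *ᵥ v) = H'⁻¹ k k := by
    rw [hv, mulVec_inv_mulVec_single hH, hu]
    simp
  have hvv : v ⬝ᵥ (H *ᵥ v) = H⁻¹ k k := inv_mulVec_single_dotProduct hH k
  have huu : u ⬝ᵥ (H' *ᵥ u) = H'⁻¹ k k := inv_mulVec_single_dotProduct hH' k
  have h2 := h u
  rw [huu] at h2
  rw [Matrix.mulVec_sub, Matrix.mulVec_smul, dotProduct_sub, sub_dotProduct, sub_dotProduct,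
    smul_dotProduct, dotProduct_smul, smul_dotProduct, dotProduct_smul, hsymm, huv, hvv] at h1
  simp only [smul_eq_mul] at h1
  have h3 : r⁻¹ * (r⁻¹ * u ⬝ᵥ (H *ᵥ u)) ≤ r⁻¹ * (r⁻¹ * (r * H'⁻¹ k k)) := by gcongr
  rw [inv_mul_cancel_left₀ hr.ne'] at h3
  have h4 : r⁻¹ * H'⁻¹ k k ≤ H⁻¹ k k := by linarith
  rwa [inv_mul_le_iff₀ hr] at h4

end Inverse

/-! ### Weighted Gram matrices and their quadratic forms. -/

section Gram

variable {ι : Type*} [Fintype ι] [DecidableEq ι] {d : ℕ}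

/-- The weighted Gram matrix `∑ w e • x e (x e)ᵀ`. -/
noncomputable def weightedGram (w : ι → ℝ) (x : ι → Fin d → ℝ) : Matrix (Fin d) (Fin d) ℝ :=
  (Matrix.of x)ᵀ * Matrix.diagonal w * Matrix.of x

lemma dotProduct_weightedGram_mulVec (w : ι → ℝ) (x : ι → Fin d → ℝ) (u v : Fin d → ℝ) :
    u ⬝ᵥ (weightedGram w x *ᵥ v) = ∑ e, w e * (x e ⬝ᵥ u) * (x e ⬝ᵥ v) := by
  rw [weightedGram, ← Matrix.mulVec_mulVec, ← Matrix.mulVec_mulVec, Matrix.dotProduct_mulVec,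
    Matrix.vecMul_transpose, dotProduct]
  refine Finset.sum_congr rfl fun e _ => ?_
  rw [Matrix.mulVec_diagonal]
  simp only [Matrix.mulVec, Matrix.of_apply]
  ring

lemma weightedGram_posDef {w : ι → ℝ} {x : ι → Fin d → ℝ} {m l : ℝ} (hm : 0 < m) (hl : 0 < l)
    (hw : ∀ e, m ≤ w e) (hx : ∀ u, l * ‖u‖ ^ 2 ≤ ∑ e, (x e ⬝ᵥ u) ^ 2) :
    (weightedGram w x).PosDef := by
  refine Matrix.PosDef.of_dotProduct_mulVec_pos ?_ fun u hu => ?_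
  · unfold weightedGram
    rw [Matrix.IsHermitian, Matrix.conjTranspose_eq_transpose_of_trivial]
    simp [Matrix.transpose_mul, Matrix.mul_assoc]
  · rw [star_trivial, dotProduct_weightedGram_mulVec]
    have h1 : 0 < m * (l * ‖u‖ ^ 2) := by
      have := norm_pos_iff.2 hu
      positivity
    have h2 : m * (l * ‖u‖ ^ 2) ≤ m * ∑ e, (x e ⬝ᵥ u) ^ 2 := by gcongr; exact hx u
    refine h1.trans_le (h2.trans ?_)
    rw [Finset.mul_sum]
    refine Finset.sum_le_sum fun e _ => ?_
    rw [mul_assoc, ← sq]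
    gcongr
    exact hw e

lemma le_dotProduct_weightedGram_mulVec {w : ι → ℝ} {x : ι → Fin d → ℝ} {m l : ℝ} (hm : 0 < m)
    (hw : ∀ e, m ≤ w e) (hx : ∀ u, l * ‖u‖ ^ 2 ≤ ∑ e, (x e ⬝ᵥ u) ^ 2) (u : Fin d → ℝ) :
    m * (l * ‖u‖ ^ 2) ≤ u ⬝ᵥ (weightedGram w x *ᵥ u) := by
  rw [dotProduct_weightedGram_mulVec]
  have h2 : m * (l * ‖u‖ ^ 2) ≤ m * ∑ e, (x e ⬝ᵥ u) ^ 2 := by gcongr; exact hx u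
  refine h2.trans ?_
  rw [Finset.mul_sum]
  refine Finset.sum_le_sum fun e _ => ?_
  rw [mul_assoc, ← sq]
  gcongr
  exact hw e

end Gram

/-- The constant of `le_logisticVar`. -/
noncomputable def logisticVarLower (B : ℝ) : ℝ := Real.exp (-B) / (1 + Real.exp B) ^ 2

lemma logisticVarLower_pos (B : ℝ) : 0 < logisticVarLower B := by
  unfold logisticVarLower; positivity

/-! ### Deterministic error bound for a parameter of small loss. -/

section Estimate

variable {ι : Type*} [Fintype ι] {d : ℕ}

/-- The score of the logistic model at `θ`. -/
noncomputable def score (ε : ℝ) (x : ι → Fin d → ℝ) (y : ι → ℝ) (θ : Fin d → ℝ) : Fin d → ℝ :=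
  fun j => ∑ e, (y e - logisticProb ε (x e ⬝ᵥ θ)) * x e j

lemma score_dotProduct (ε : ℝ) (x : ι → Fin d → ℝ) (y : ι → ℝ) (θ u : Fin d → ℝ) :
    score ε x y θ ⬝ᵥ u = ∑ e, (y e - logisticProb ε (x e ⬝ᵥ θ)) * (x e ⬝ᵥ u) := by
  simp only [score, dotProduct, Finset.sum_mul, Finset.mul_sum]
  rw [Finset.sum_comm]
  exact Finset.sum_congr rfl fun e _ => Finset.sum_congr rfl fun j _ => by ring

/-- The negative log-likelihood of the logistic model. -/
noncomputable def logisticLoss (ε : ℝ) (x : ι → Fin d → ℝ) (y : ι → ℝ) (θ : Fin d → ℝ) : ℝ :=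
  ∑ e, (Real.log (1 + ε * Real.exp (x e ⬝ᵥ θ)) - y e * (x e ⬝ᵥ θ))

/-- Strong convexity at `θ₀` turns a nonpositive loss difference into `m ε l / 2 * ‖δ‖² ≤ S ⬝ᵥ δ ≤ d
‖S‖ ‖δ‖`. Nothing is asked of the gradient at `θ`, so the bound applies before the minimizer is
known to be interior. -/
lemma norm_sub_le_of_logisticLoss_le {ε l B : ℝ} {x : ι → Fin d → ℝ} {y : ι → ℝ}
    {θ₀ θ : Fin d → ℝ} (hε : 0 < ε) (hε1 : ε ≤ 1) (hl : 0 < l)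
    (hx : ∀ u, l * ‖u‖ ^ 2 ≤ ∑ e, (x e ⬝ᵥ u) ^ 2)
    (h₀ : ∀ e, |x e ⬝ᵥ θ₀| ≤ B) (h : ∀ e, |x e ⬝ᵥ θ| ≤ B)
    (hle : logisticLoss ε x y θ ≤ logisticLoss ε x y θ₀) :
    ‖θ - θ₀‖ ≤ 2 * d / logisticVarLower B * (‖score ε x y θ₀‖ / (ε * l)) := by
  set δ := θ - θ₀ with hδ
  have hm := logisticVarLower_pos B
  have key : logisticVarLower B * ε / 2 * ∑ e, (x e ⬝ᵥ δ) ^ 2 ≤ score ε x y θ₀ ⬝ᵥ δ := by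
    have : ∑ e, (logisticVarLower B * ε / 2 * (x e ⬝ᵥ δ) ^ 2 -
        (y e - logisticProb ε (x e ⬝ᵥ θ₀)) * (x e ⬝ᵥ δ)) ≤
        logisticLoss ε x y θ - logisticLoss ε x y θ₀ := by
      rw [logisticLoss, logisticLoss, ← Finset.sum_sub_distrib]
      refine Finset.sum_le_sum fun e _ => ?_
      have := log_one_add_mul_exp_strong_convex hε hε1 (h₀ e) (h e)
      rw [← dotProduct_sub, ← hδ] at this
      have e1 : y e * (x e ⬝ᵥ θ) - y e * (x e ⬝ᵥ θ₀) = y e * (x e ⬝ᵥ δ) := by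
        rw [hδ, dotProduct_sub]; ring
      unfold logisticVarLower
      linarith
    rw [Finset.sum_sub_distrib, ← Finset.mul_sum, ← score_dotProduct] at this
    linarith
  have h1 := le_of_abs_le (abs_dotProduct_le (score ε x y θ₀) δ)
  have h2 : logisticVarLower B * ε / 2 * (l * ‖δ‖ ^ 2) ≤
      logisticVarLower B * ε / 2 * ∑ e, (x e ⬝ᵥ δ) ^ 2 := by gcongr; exact hx δ
  have h3 : logisticVarLower B * ε / 2 * (l * ‖δ‖ ^ 2) ≤ d * (‖score ε x y θ₀‖ * ‖δ‖) := by
    linarith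
  rcases (norm_nonneg δ).eq_or_lt with h0 | h0
  · rw [← h0]; positivity
  · have h4 : logisticVarLower B * ε / 2 * l * ‖δ‖ ≤ d * ‖score ε x y θ₀‖ := by
      refine le_of_mul_le_mul_right ?_ h0
      linarith
    rw [div_mul_div_comm, le_div_iff₀ (by positivity)]
    linarith

/-- Compares standard errors at two parameters: `a / b` lies in `[e^(-r), e^r]`, and the deviation
of its root from one is linear in `r`. -/
lemma abs_sqrt_div_sub_one_le {a b r : ℝ} (ha : 0 < a) (hb : 0 < b)
    (hab : a ≤ Real.exp r * b) (hba : b ≤ Real.exp r * a) (hr : 0 ≤ r) :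
    |√(a / b) - 1| ≤ r * Real.exp r := by
  have h4 : Real.exp r - 1 ≤ r * Real.exp r := by
    have := Real.add_one_le_exp (-r)
    rw [Real.exp_neg] at this
    have hp := Real.exp_pos r
    have : (-r + 1) * Real.exp r ≤ (Real.exp r)⁻¹ * Real.exp r := by gcongr
    rw [inv_mul_cancel₀ hp.ne'] at this
    linarith
  have h1 : 1 ≤ Real.exp r := Real.one_le_exp hr
  have hq : a / b ≤ Real.exp r := by rwa [div_le_iff₀ hb]
  have hq' : (Real.exp r)⁻¹ ≤ a / b := by
    rw [le_div_iff₀ hb, inv_mul_le_iff₀ (Real.exp_pos r)]; exact hba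
  have hs : √(a / b) ≤ Real.exp r := by
    rw [Real.sqrt_le_left (Real.exp_pos r).le]
    nlinarith
  have hs' : 1 - r ≤ √(a / b) := by
    have h5 : 1 - r ≤ (Real.exp r)⁻¹ := by
      rw [← Real.exp_neg]; linarith [Real.add_one_le_exp (-r)]
    refine h5.trans (Real.le_sqrt_of_sq_le (le_trans ?_ hq'))
    have : (Real.exp r)⁻¹ ≤ 1 := inv_le_one_of_one_le₀ h1
    have : 0 < (Real.exp r)⁻¹ := inv_pos.2 (Real.exp_pos r)
    nlinarith
  rw [abs_le]
  constructor <;> nlinarith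

end Estimate

/-! ### Linearisation of the studentized estimator. -/

section Hessian

variable {ι : Type*} [Fintype ι] [DecidableEq ι] {d : ℕ}

/-- The Hessian of `logisticLoss` at `θ`. -/
noncomputable def hessian (ε : ℝ) (x : ι → Fin d → ℝ) (θ : Fin d → ℝ) :
    Matrix (Fin d) (Fin d) ℝ :=
  weightedGram (fun e => logisticVar ε (x e ⬝ᵥ θ)) x

/-- The linearised coefficients of the `k`-th coordinate of the estimator, normalised to have
conditional variance one. -/
noncomputable def influence (ε : ℝ) (x : ι → Fin d → ℝ) (θ : Fin d → ℝ) (k : Fin d) (e : ι) : ℝ :=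
  (x e ⬝ᵥ ((hessian ε x θ)⁻¹ *ᵥ Pi.single k 1)) / √((hessian ε x θ)⁻¹ k k)

variable {ε l b B : ℝ} {x : ι → Fin d → ℝ} {y : ι → ℝ} {θ₀ θ : Fin d → ℝ}

lemma hessian_posDef (hε : 0 < ε) (hε1 : ε ≤ 1) (hl : 0 < l)
    (hx : ∀ u, l * ‖u‖ ^ 2 ≤ ∑ e, (x e ⬝ᵥ u) ^ 2) (h₀ : ∀ e, |x e ⬝ᵥ θ₀| ≤ B) :
    (hessian ε x θ₀).PosDef :=
  weightedGram_posDef (mul_pos (logisticVarLower_pos B) hε) hl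
    (fun e => le_logisticVar hε hε1 (h₀ e)) hx

/-- For `v = H⁻¹ e_k` one has `vᵀ H v = H⁻¹ k k`, while the Gram bound gives `vᵀ H v ≥ m ε l ‖v‖²`.
-/
lemma norm_inv_mulVec_single_le (hε : 0 < ε) (hε1 : ε ≤ 1) (hl : 0 < l)
    (hx : ∀ u, l * ‖u‖ ^ 2 ≤ ∑ e, (x e ⬝ᵥ u) ^ 2) (h₀ : ∀ e, |x e ⬝ᵥ θ₀| ≤ B) (k : Fin d) :
    ‖(hessian ε x θ₀)⁻¹ *ᵥ Pi.single k 1‖ ≤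
      √((hessian ε x θ₀)⁻¹ k k) / √(logisticVarLower B * (ε * l)) := by
  have hm := logisticVarLower_pos B
  have hH := hessian_posDef hε hε1 hl hx h₀
  rw [← Real.sqrt_div (inv_apply_pos hH k).le]
  refine Real.le_sqrt_of_sq_le ?_
  rw [le_div_iff₀ (by positivity)]
  have := le_dotProduct_weightedGram_mulVec (mul_pos hm hε)
    (fun e => le_logisticVar hε hε1 (h₀ e)) hx ((hessian ε x θ₀)⁻¹ *ᵥ Pi.single k 1)
  have h2 := inv_mulVec_single_dotProduct hH k
  rw [← h2]
  refine le_trans (le_of_eq ?_) this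
  ring

/-- The negligibility condition of the central limit theorem: the standard error cancels and every
coefficient is `O((ε l)^(-1/2))`, where `l` will be of order `N`. -/
lemma abs_influence_le (hε : 0 < ε) (hε1 : ε ≤ 1) (hl : 0 < l)
    (hx : ∀ u, l * ‖u‖ ^ 2 ≤ ∑ e, (x e ⬝ᵥ u) ^ 2) (hb : ∀ e, ‖x e‖ ≤ b)
    (h₀ : ∀ e, |x e ⬝ᵥ θ₀| ≤ B) (k : Fin d) (e : ι) :
    |influence ε x θ₀ k e| ≤ d * b / √(logisticVarLower B * (ε * l)) := by
  have hH := hessian_posDef hε hε1 hl hx h₀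
  have hV : 0 < √((hessian ε x θ₀)⁻¹ k k) := Real.sqrt_pos.2 (inv_apply_pos hH k)
  rw [influence, abs_div, abs_of_pos hV, div_le_iff₀ hV]
  calc _ ≤ _ := abs_dotProduct_le _ _
    _ ≤ d * (b * (√((hessian ε x θ₀)⁻¹ k k) / √(logisticVarLower B * (ε * l)))) := by
        have := norm_inv_mulVec_single_le hε hε1 hl hx h₀ k
        have hb0 : 0 ≤ b := (norm_nonneg _).trans (hb e)
        gcongr
        exact hb e
    _ = _ := by ring

/-- The sum is `vᵀ H v / H⁻¹ k k` with `v = H⁻¹ e_k`; it is the conditional variance of the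
normalised score. -/
lemma sum_influence_sq (hε : 0 < ε) (hε1 : ε ≤ 1) (hl : 0 < l)
    (hx : ∀ u, l * ‖u‖ ^ 2 ≤ ∑ e, (x e ⬝ᵥ u) ^ 2)
    (h₀ : ∀ e, |x e ⬝ᵥ θ₀| ≤ B) (k : Fin d) :
    ∑ e, influence ε x θ₀ k e ^ 2 * logisticVar ε (x e ⬝ᵥ θ₀) = 1 := by
  have hH := hessian_posDef hε hε1 hl hx h₀
  have hV := inv_apply_pos hH k
  have h2 := inv_mulVec_single_dotProduct hH k
  rw [hessian, dotProduct_weightedGram_mulVec, ← hessian] at h2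
  calc _ = (∑ e, logisticVar ε (x e ⬝ᵥ θ₀) * (x e ⬝ᵥ ((hessian ε x θ₀)⁻¹ *ᵥ Pi.single k 1)) *
        (x e ⬝ᵥ ((hessian ε x θ₀)⁻¹ *ᵥ Pi.single k 1))) / (hessian ε x θ₀)⁻¹ k k := by
        rw [Finset.sum_div]
        refine Finset.sum_congr rfl fun e _ => ?_
        rw [influence, div_pow, Real.sq_sqrt hV.le]
        ring
    _ = 1 := by rw [h2, div_self hV.ne']

lemma sum_mul_influence (r : ι → ℝ) (k : Fin d) :
    ∑ e, r e * influence ε x θ₀ k e =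
      (∑ e, r e * (x e ⬝ᵥ ((hessian ε x θ₀)⁻¹ *ᵥ Pi.single k 1))) /
        √((hessian ε x θ₀)⁻¹ k k) := by
  rw [Finset.sum_div]
  exact Finset.sum_congr rfl fun e _ => by rw [influence]; ring

/-- Two errors are incurred: the quadratic remainder of the score expansion, and the replacement of
the standard error at `θ₀` by the one at `θ`. Each has the same bound of order `ε N ‖δ‖² / √(ε l)`,
hence the factor 2; the cube of `d * b` comes from two predictor increments and one coefficient
bound. -/
lemma abs_studentized_sub_le (hε : 0 < ε) (hε1 : ε ≤ 1) (hl : 0 < l)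
    (hx : ∀ u, l * ‖u‖ ^ 2 ≤ ∑ e, (x e ⬝ᵥ u) ^ 2) (hb0 : 0 ≤ b) (hb : ∀ e, ‖x e‖ ≤ b)
    (h₀ : ∀ e, |x e ⬝ᵥ θ₀| ≤ B) (hscore : score ε x y θ = 0) (hδ1 : ‖θ - θ₀‖ ≤ 1) (k : Fin d) :
    (hessian ε x θ).PosDef ∧
    |(θ k - θ₀ k) / √((hessian ε x θ)⁻¹ k k) -
        ∑ e, (y e - logisticProb ε (x e ⬝ᵥ θ₀)) * influence ε x θ₀ k e| ≤
      2 * (d * b) ^ 3 * Real.exp (d * b) * Real.exp B / √(logisticVarLower B) *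
        (ε * Fintype.card ι / √(ε * l) * ‖θ - θ₀‖ ^ 2) := by
  have hm := logisticVarLower_pos B
  have hH := hessian_posDef hε hε1 hl hx h₀
  set δ := θ - θ₀ with hδ
  set V := (hessian ε x θ₀)⁻¹ k k with hVdef
  set V' := (hessian ε x θ)⁻¹ k k with hV'def
  set v := (hessian ε x θ₀)⁻¹ *ᵥ Pi.single k 1 with hv
  set c := influence ε x θ₀ k with hc
  have hcB : ∀ e, |c e| ≤ _ := abs_influence_le hε hε1 hl hx hb h₀ k
  set κ := d * b / √(logisticVarLower B * (ε * l)) with hκ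
  set r := d * b * ‖δ‖ with hr
  have hr0 : 0 ≤ r := by positivity
  have hrdb : r ≤ d * b := by
    calc r ≤ d * b * 1 := by rw [hr]; gcongr
      _ = _ := mul_one _
  have hκ0 : 0 ≤ κ := by positivity
  set h : ι → ℝ := fun e => x e ⬝ᵥ θ - x e ⬝ᵥ θ₀ with hh
  have hhd : ∀ e, h e = x e ⬝ᵥ δ := fun e => by rw [hδ, dotProduct_sub]
  have hhr : ∀ e, |h e| ≤ r := fun e => by
    rw [hhd, hr, mul_assoc]
    refine (abs_dotProduct_le _ _).trans ?_
    gcongr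
    exact hb e
  have hw : ∀ e, 0 < logisticVar ε (x e ⬝ᵥ θ₀) := fun e => logisticVar_pos hε _
  have hww' : ∀ e, logisticVar ε (x e ⬝ᵥ θ) ≤ Real.exp r * logisticVar ε (x e ⬝ᵥ θ₀) := fun e =>
    (logisticVar_le_exp_abs_mul hε _ _).trans
      (mul_le_mul_of_nonneg_right (Real.exp_le_exp.2 (hhr e)) (hw e).le)
  have hw'w : ∀ e, logisticVar ε (x e ⬝ᵥ θ₀) ≤ Real.exp r * logisticVar ε (x e ⬝ᵥ θ) := fun e => by
    refine (logisticVar_le_exp_abs_mul hε _ _).trans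
      (mul_le_mul_of_nonneg_right (Real.exp_le_exp.2 ?_) (logisticVar_pos hε _).le)
    rw [abs_sub_comm]
    exact hhr e
  have hH' : (hessian ε x θ).PosDef := by
    refine weightedGram_posDef (m := (Real.exp r)⁻¹ * (logisticVarLower B * ε))
      (by positivity) hl (fun e => ?_) hx
    rw [inv_mul_le_iff₀ (Real.exp_pos r)]
    exact (le_logisticVar hε hε1 (h₀ e)).trans (hw'w e)
  refine ⟨hH', ?_⟩
  have hV : 0 < V := inv_apply_pos hH k
  have hV' : 0 < V' := inv_apply_pos hH' k
  have hform : ∀ {s t : ι → ℝ}, (∀ e, s e ≤ Real.exp r * t e) → ∀ u,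
      u ⬝ᵥ (weightedGram s x *ᵥ u) ≤ Real.exp r * (u ⬝ᵥ (weightedGram t x *ᵥ u)) := by
    intro s t hst u
    rw [dotProduct_weightedGram_mulVec, dotProduct_weightedGram_mulVec, Finset.mul_sum]
    refine Finset.sum_le_sum fun e _ => ?_
    have := mul_le_mul_of_nonneg_right (hst e) (mul_self_nonneg (x e ⬝ᵥ u))
    linarith
  have hV'V : V' ≤ Real.exp r * V := inv_apply_le_mul hH hH' (Real.exp_pos r) (hform hw'w) k
  have hVV' : V ≤ Real.exp r * V' := inv_apply_le_mul hH' hH (Real.exp_pos r) (hform hww') k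
  have hsV := Real.sqrt_pos.2 hV
  have hsV' := Real.sqrt_pos.2 hV'
  -- the linear part
  have hlin : ∑ e, logisticVar ε (x e ⬝ᵥ θ₀) * h e * c e = δ k / √V := by
    rw [hc, sum_mul_influence]
    congr 1
    have h1 := mulVec_inv_mulVec_single hH k
    rw [← hv] at h1
    have h2 : δ ⬝ᵥ (hessian ε x θ₀ *ᵥ v) = δ k := by rw [h1]; simp
    rw [← h2]
    conv_rhs => rw [hessian, dotProduct_weightedGram_mulVec]
    exact Finset.sum_congr rfl fun e _ => by rw [hhd]
  set q : ι → ℝ := fun e => logisticProb ε (x e ⬝ᵥ θ) - logisticProb ε (x e ⬝ᵥ θ₀) -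
    logisticVar ε (x e ⬝ᵥ θ₀) * h e with hq
  -- Since the score vanishes at `θ`, `y e` may be replaced by the fitted probability at `θ`, whose
  -- increment is the linear part plus `q e`.
  have hU : ∑ e, (y e - logisticProb ε (x e ⬝ᵥ θ₀)) * c e = δ k / √V + ∑ e, q e * c e := by
    have h0 : ∑ e, (y e - logisticProb ε (x e ⬝ᵥ θ)) * c e = 0 := by
      rw [hc, sum_mul_influence, ← score_dotProduct, hscore, zero_dotProduct, zero_div]
    rw [← hlin, ← Finset.sum_add_distrib, ← sub_eq_zero, ← Finset.sum_sub_distrib]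
    refine Eq.trans (Finset.sum_congr rfl fun e _ => ?_) h0
    simp only [hq]
    ring
  have hwB : ∀ e, logisticVar ε (x e ⬝ᵥ θ₀) ≤ Real.exp B * ε := fun e => logisticVar_le hε (h₀ e)
  set N : ℝ := (Fintype.card ι : ℝ) with hN
  have hrem : |∑ e, q e * c e| ≤ N * (r ^ 2 * Real.exp (d * b) * (Real.exp B * ε) * κ) := by
    calc _ ≤ ∑ e, |q e * c e| := Finset.abs_sum_le_sum_abs _ _
      _ ≤ ∑ _e : ι, r ^ 2 * Real.exp (d * b) * (Real.exp B * ε) * κ := by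
        refine Finset.sum_le_sum fun e _ => ?_
        rw [abs_mul]
        refine mul_le_mul ?_ (hcB e) (abs_nonneg _) (by positivity)
        refine (abs_logisticProb_sub_sub_le hε _ _).trans ?_
        refine mul_le_mul ?_ (hwB e) (hw e).le (by positivity)
        gcongr
        · exact hhr e
        · exact (hhr e).trans hrdb
      _ = _ := by simp [hN]
  -- First order in `δ` is enough here, because this term is multiplied by `√(V / V') - 1`, itself
  -- of order `‖δ‖`.
  have hmain : |δ k / √V| ≤ N * (Real.exp B * ε * r * κ) := by
    rw [← hlin]
    calc _ ≤ ∑ e, |logisticVar ε (x e ⬝ᵥ θ₀) * h e * c e| := Finset.abs_sum_le_sum_abs _ _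
      _ ≤ ∑ _e : ι, Real.exp B * ε * r * κ := by
        refine Finset.sum_le_sum fun e _ => ?_
        rw [abs_mul, abs_mul, abs_of_pos (hw e)]
        refine mul_le_mul ?_ (hcB e) (abs_nonneg _) (by positivity)
        exact mul_le_mul (hwB e) (hhr e) (abs_nonneg _) (by positivity)
      _ = _ := by simp [hN]
  have hratio := abs_sqrt_div_sub_one_le hV hV' hVV' hV'V hr0
  have hdecomp : (θ k - θ₀ k) / √V' - ∑ e, (y e - logisticProb ε (x e ⬝ᵥ θ₀)) * c e =
      δ k / √V * (√(V / V') - 1) - ∑ e, q e * c e := by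
    rw [hU, Real.sqrt_div hV.le, hδ, Pi.sub_apply]
    field_simp
    ring
  rw [hdecomp]
  refine (abs_sub _ _).trans ?_
  rw [abs_mul]
  have hfirst : |δ k / √V| * |√(V / V') - 1| ≤
      N * (Real.exp B * ε * r * κ) * (r * Real.exp (d * b)) :=
    mul_le_mul hmain (hratio.trans (by gcongr)) (abs_nonneg _) (by positivity)
  refine (add_le_add hfirst hrem).trans (le_of_eq ?_)
  rw [hκ, hr, Real.sqrt_mul hm.le]
  field_simp
  ring

end Hessian

/-! ### Bernoulli sums: variance and characteristic function. -/

/-- The probability mass function of a Bernoulli variable with success probability `p`. -/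
noncomputable def bernoulliWeight (p : ℝ) (b : Bool) : ℝ := if b then p else 1 - p

/-- The value of an edge indicator as a real number. -/
noncomputable def edgeValue (b : Bool) : ℝ := if b then 1 else 0

lemma bernoulliWeight_nonneg {p : ℝ} (h0 : 0 ≤ p) (h1 : p ≤ 1) (b : Bool) :
    0 ≤ bernoulliWeight p b := by
  unfold bernoulliWeight
  split_ifs <;> linarith

/-- Independence in finite form: under product weights, the expectation of a product is the product
of the expectations. -/
lemma sum_prod_pi_bool {ι R : Type*} [Fintype ι] [DecidableEq ι] [CommSemiring R]
    (g : ι → Bool → R) : ∑ a : ι → Bool, ∏ e, g e (a e) = ∏ e, ∑ b, g e b := by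
  rw [Finset.prod_univ_sum, Fintype.piFinset_univ]

/-- Off-diagonal terms factor over the coordinates and contain a centred factor of mean zero; only
the variances remain. -/
lemma sum_prod_bernoulliWeight_mul_sq {ι : Type*} [Fintype ι] [DecidableEq ι] (p c : ι → ℝ) :
    ∑ a : ι → Bool, (∏ e, bernoulliWeight (p e) (a e)) *
      (∑ e, (edgeValue (a e) - p e) * c e) ^ 2 = ∑ e, c e ^ 2 * (p e * (1 - p e)) := by
  have key : ∀ e f : ι, ∑ a : ι → Bool, (∏ i, bernoulliWeight (p i) (a i)) *
      ((edgeValue (a e) - p e) * (edgeValue (a f) - p f)) =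
      if e = f then p e * (1 - p e) else 0 := by
    intro e f
    have h1 : ∀ a : ι → Bool, (∏ i, bernoulliWeight (p i) (a i)) *
        ((edgeValue (a e) - p e) * (edgeValue (a f) - p f)) =
        ∏ i, bernoulliWeight (p i) (a i) * ((if i = e then edgeValue (a i) - p i else 1) *
          (if i = f then edgeValue (a i) - p i else 1)) := fun a => by
      rw [Finset.prod_mul_distrib, Finset.prod_mul_distrib, Finset.prod_ite_eq',
        Finset.prod_ite_eq']
      simp
    rw [Finset.sum_congr rfl fun a _ => h1 a, sum_prod_pi_bool (fun i b =>
      bernoulliWeight (p i) b * ((if i = e then edgeValue b - p i else 1) *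
          (if i = f then edgeValue b - p i else 1)))]
    split_ifs with hef
    · subst hef
      rw [Finset.prod_eq_single e]
      · simp [bernoulliWeight, edgeValue]; ring
      · intro i _ hi
        simp [bernoulliWeight, hi]
      · simp
    · refine Finset.prod_eq_zero (Finset.mem_univ e) ?_
      simp [bernoulliWeight, edgeValue, hef]
      ring
  have h2 : ∀ a : ι → Bool, (∏ e, bernoulliWeight (p e) (a e)) *
      (∑ e, (edgeValue (a e) - p e) * c e) ^ 2 = ∑ e, ∑ f, c e * c f *
        ((∏ i, bernoulliWeight (p i) (a i)) *
          ((edgeValue (a e) - p e) * (edgeValue (a f) - p f))) := fun a => by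
    rw [sq, Finset.sum_mul_sum, Finset.mul_sum]
    refine Finset.sum_congr rfl fun e _ => ?_
    rw [Finset.mul_sum]
    exact Finset.sum_congr rfl fun f _ => by ring
  rw [Finset.sum_congr rfl fun a _ => h2 a, Finset.sum_comm]
  refine Finset.sum_congr rfl fun e _ => ?_
  rw [Finset.sum_comm]
  simp_rw [← Finset.mul_sum, key, sq]
  simp

/-- Telescoping: the factors are exchanged one at a time, and all the others have modulus at most
one. -/
lemma norm_prod_sub_prod_le {ι : Type*} (s : Finset ι) (f g : ι → ℂ) (hf : ∀ i, ‖f i‖ ≤ 1)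
    (hg : ∀ i, ‖g i‖ ≤ 1) : ‖∏ i ∈ s, f i - ∏ i ∈ s, g i‖ ≤ ∑ i ∈ s, ‖f i - g i‖ := by
  classical
  induction s using Finset.induction_on with
  | empty => simp
  | insert i s hi ih =>
    rw [Finset.prod_insert hi, Finset.prod_insert hi, Finset.sum_insert hi]
    have hP : ‖∏ i ∈ s, f i‖ ≤ 1 := by
      rw [norm_prod]
      exact Finset.prod_le_one (fun _ _ => norm_nonneg _) fun i _ => hf i
    calc _ = ‖(f i - g i) * ∏ i ∈ s, f i + g i * (∏ i ∈ s, f i - ∏ i ∈ s, g i)‖ := by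
          congr 1; ring
      _ ≤ ‖f i - g i‖ * ‖∏ i ∈ s, f i‖ + ‖g i‖ * ‖∏ i ∈ s, f i - ∏ i ∈ s, g i‖ := by
          refine (norm_add_le _ _).trans ?_
          rw [norm_mul, norm_mul]
      _ ≤ ‖f i - g i‖ * 1 + 1 * ∑ i ∈ s, ‖f i - g i‖ := by
          gcongr
          exact hg i
      _ = _ := by ring

/-- The characteristic function of a centred Bernoulli variable. -/
noncomputable def bernoulliCharFun (p s : ℝ) : ℂ :=
  ∑ b, (bernoulliWeight p b : ℂ) * Complex.exp ((s * (edgeValue b - p) : ℝ) * Complex.I)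

lemma norm_bernoulliCharFun_le {p : ℝ} (h0 : 0 ≤ p) (h1 : p ≤ 1) (s : ℝ) :
    ‖bernoulliCharFun p s‖ ≤ 1 := by
  refine (norm_sum_le _ _).trans ?_
  have : ∀ b, ‖(bernoulliWeight p b : ℂ) *
      Complex.exp ((s * (edgeValue b - p) : ℝ) * Complex.I)‖ = bernoulliWeight p b := fun b => by
    rw [norm_mul, Complex.norm_exp_ofReal_mul_I, mul_one, Complex.norm_real, Real.norm_eq_abs,
      abs_of_nonneg (bernoulliWeight_nonneg h0 h1 b)]
  simp_rw [this]
  simp [bernoulliWeight]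

lemma norm_exp_mul_I_sub_taylor_le {x : ℝ} (hx : |x| ≤ 1) :
    ‖Complex.exp (x * Complex.I) - (1 + x * Complex.I - x ^ 2 / 2)‖ ≤ 3 * |x| ^ 3 := by
  have h := Complex.norm_exp_sub_sum_le_norm_mul_exp (x * Complex.I) 3
  have hn : ‖(x : ℂ) * Complex.I‖ = |x| := by simp
  rw [hn] at h
  have h3 : Real.exp |x| ≤ 3 :=
    (Real.exp_le_exp.2 hx).trans (by linarith [Real.exp_one_lt_d9])
  have he : ∑ m ∈ Finset.range 3, ((x : ℂ) * Complex.I) ^ m / (m.factorial : ℂ) =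
      1 + x * Complex.I - x ^ 2 / 2 := by
    simp [Finset.sum_range_succ, mul_pow, Nat.factorial]
    ring
  rw [he] at h
  refine h.trans ?_
  rw [mul_comm]
  gcongr

/-- Both functions are compared with `1 - s² p (1 - p) / 2`. The error keeps the factor `p (1 - p)`,
so that errors can be summed against the variance normalisation even when `p` is small; a bare
`|s|³` would not suffice in sparse networks. -/
lemma norm_bernoulliCharFun_sub_le {p s : ℝ} (h0 : 0 ≤ p) (h1 : p ≤ 1) (hs : |s| ≤ 1) :
    ‖bernoulliCharFun p s - Complex.exp ((-(s ^ 2 * (p * (1 - p))) / 2 : ℝ))‖ ≤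
      4 * |s| * (s ^ 2 * (p * (1 - p))) := by
  have hs0 := abs_nonneg s
  have hq : 0 ≤ p * (1 - p) := mul_nonneg h0 (by linarith)
  have hq1 : p * (1 - p) ≤ 1 := by nlinarith
  have hs2 : s ^ 2 ≤ 1 := by rw [← sq_abs]; exact pow_le_one₀ hs0 hs
  -- the Bernoulli part
  have hA : ‖bernoulliCharFun p s - (1 - s ^ 2 * (p * (1 - p)) / 2 : ℝ)‖ ≤
      3 * |s| * (s ^ 2 * (p * (1 - p))) := by
    have hx1 : |s * (1 - p)| ≤ |s| := by
      rw [abs_mul, abs_of_nonneg (by linarith : 0 ≤ 1 - p)]; nlinarith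
    have hx2 : |s * (0 - p)| ≤ |s| := by
      rw [abs_mul, zero_sub, abs_neg, abs_of_nonneg h0]; nlinarith
    have e1 := norm_exp_mul_I_sub_taylor_le (hx1.trans hs)
    have e2 := norm_exp_mul_I_sub_taylor_le (hx2.trans hs)
    have hd : bernoulliCharFun p s - (1 - s ^ 2 * (p * (1 - p)) / 2 : ℝ) =
        (p : ℂ) * (Complex.exp ((s * (1 - p) : ℝ) * Complex.I) -
          (1 + (s * (1 - p) : ℝ) * Complex.I - (s * (1 - p) : ℝ) ^ 2 / 2)) +
        ((1 - p : ℝ) : ℂ) * (Complex.exp ((s * (0 - p) : ℝ) * Complex.I) -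
          (1 + (s * (0 - p) : ℝ) * Complex.I - (s * (0 - p) : ℝ) ^ 2 / 2)) := by
      simp [bernoulliCharFun, bernoulliWeight, edgeValue]
      ring
    rw [hd]
    refine (norm_add_le _ _).trans ?_
    rw [norm_mul, norm_mul, Complex.norm_real, Complex.norm_real, Real.norm_of_nonneg h0,
      Real.norm_of_nonneg (by linarith : 0 ≤ 1 - p)]
    have e1' : p * _ ≤ _ := mul_le_mul_of_nonneg_left e1 h0
    have e2' : (1 - p) * _ ≤ _ := mul_le_mul_of_nonneg_left e2 (by linarith : 0 ≤ 1 - p)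
    refine (add_le_add e1' e2').trans ?_
    rw [abs_mul, abs_mul, zero_sub, abs_neg, abs_of_nonneg h0,
      abs_of_nonneg (by linarith : 0 ≤ 1 - p), ← sq_abs s]
    -- The average of the two cubic remainders contains the variance `p (1 - p)`, times a factor `(1
    -- - p)² + p² ≤ 1`.
    have : p * (3 * (|s| * (1 - p)) ^ 3) + (1 - p) * (3 * (|s| * p) ^ 3) =
        3 * |s| * (|s| ^ 2 * (p * (1 - p))) * ((1 - p) ^ 2 + p ^ 2) := by ring
    rw [this]
    refine mul_le_of_le_one_right (by positivity) ?_
    nlinarith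
  have hB : ‖((1 - s ^ 2 * (p * (1 - p)) / 2 : ℝ) : ℂ) -
      Complex.exp ((-(s ^ 2 * (p * (1 - p))) / 2 : ℝ))‖ ≤ |s| * (s ^ 2 * (p * (1 - p))) := by
    rw [← Complex.ofReal_exp, ← Complex.ofReal_sub, Complex.norm_real, Real.norm_eq_abs,
      abs_sub_comm]
    set a := -(s ^ 2 * (p * (1 - p))) / 2 with ha
    have haa : s ^ 2 * (p * (1 - p)) ≤ 1 := mul_le_one₀ hs2 hq hq1
    have h2 : 0 ≤ s ^ 2 * (p * (1 - p)) := by positivity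
    have := Real.abs_exp_sub_one_sub_id_le (x := a) (by rw [abs_le]; constructor <;> linarith)
    have he : Real.exp a - (1 - s ^ 2 * (p * (1 - p)) / 2) = Real.exp a - 1 - a := by
      rw [ha]; ring
    rw [he]
    refine this.trans ?_
    have h3 : s ^ 2 * (p * (1 - p)) ≤ |s| := by
      rw [← sq_abs]
      nlinarith [mul_nonneg hs0 hq, mul_nonneg hs0 (sub_nonneg.2 hs), mul_le_mul_of_nonneg_left hq1 (sq_nonneg |s|)]
    have h4 : a ^ 2 = s ^ 2 * (p * (1 - p)) * (s ^ 2 * (p * (1 - p))) / 4 := by rw [ha]; ring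
    rw [h4]
    nlinarith [mul_le_mul_of_nonneg_right h3 h2, mul_nonneg hs0 h2]
  calc _ ≤ _ := norm_sub_le_norm_sub_add_norm_sub _ ((1 - s ^ 2 * (p * (1 - p)) / 2 : ℝ) : ℂ) _
    _ ≤ _ := add_le_add hA hB
    _ = _ := by ring

/-- A quantitative central limit theorem for weighted sums of independent Bernoulli variables. -/
lemma norm_prod_bernoulliCharFun_sub_le {ι : Type*} [Fintype ι] (p c : ι → ℝ) {κ t : ℝ}
    (h0 : ∀ e, 0 ≤ p e) (h1 : ∀ e, p e ≤ 1) (hc : ∀ e, |c e| ≤ κ)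
    (hsum : ∑ e, c e ^ 2 * (p e * (1 - p e)) = 1) (ht : |t| * κ ≤ 1) :
    ‖∏ e, bernoulliCharFun (p e) (t * c e) - Complex.exp ((-t ^ 2 / 2 : ℝ))‖ ≤
      4 * (|t| * κ) * t ^ 2 := by
  have hst : ∀ e, |t * c e| ≤ |t| * κ := fun e => by
    rw [abs_mul]; exact mul_le_mul_of_nonneg_left (hc e) (abs_nonneg _)
  have hq : ∀ e, 0 ≤ p e * (1 - p e) := fun e => mul_nonneg (h0 e) (by linarith [h1 e])
  -- Variance one lets the Gaussian characteristic function split into one Gaussian factor per edge.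
  have hexp : Complex.exp ((-t ^ 2 / 2 : ℝ)) =
      ∏ e, Complex.exp ((-((t * c e) ^ 2 * (p e * (1 - p e))) / 2 : ℝ)) := by
    rw [← Complex.exp_sum, ← Complex.ofReal_sum]
    congr 2
    rw [← Finset.sum_div, Finset.sum_neg_distrib]
    simp_rw [mul_pow, mul_assoc]
    rw [← Finset.mul_sum, hsum, mul_one]
  rw [hexp]
  refine (norm_prod_sub_prod_le _ _ _ (fun e => norm_bernoulliCharFun_le (h0 e) (h1 e) _)
    fun e => ?_).trans ?_
  · rw [← Complex.ofReal_exp, Complex.norm_real, Real.norm_of_nonneg (Real.exp_pos _).le,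
      Real.exp_le_one_iff]
    have := mul_nonneg (sq_nonneg (t * c e)) (hq e)
    linarith
  · calc _ ≤ ∑ e, 4 * (|t| * κ) * ((t * c e) ^ 2 * (p e * (1 - p e))) := by
          refine Finset.sum_le_sum fun e _ => ?_
          refine (norm_bernoulliCharFun_sub_le (h0 e) (h1 e) ((hst e).trans ht)).trans ?_
          have := mul_nonneg (sq_nonneg (t * c e)) (hq e)
          gcongr
          exact hst e
      _ = _ := by
          rw [← Finset.mul_sum]
          simp_rw [mul_pow, mul_assoc]
          rw [← Finset.mul_sum (a := t ^ 2), hsum, mul_one]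

/-- The density parameter enters through `exp (-ξ log n) = n^(-ξ)`. At `n = 0` the conventions for
`Real.log` and `rpow` disagree unless `ξ = 0`. -/
lemma linkProb_eq {p : ℕ} {n : ℕ} {ξ : ℝ} (hn : 0 < n) (μ : ℝ) (γ z : Fin p → ℝ) :
    linkProb (globalParam n ξ μ) γ z = logisticProb ((n : ℝ) ^ (-ξ)) (μ + γ ⬝ᵥ z) := by
  have hn' : (0 : ℝ) < n := by exact_mod_cast hn
  have h : Real.exp (globalParam n ξ μ + γ ⬝ᵥ z) = (n : ℝ) ^ (-ξ) * Real.exp (μ + γ ⬝ᵥ z) := by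
    rw [Real.rpow_def_of_pos hn', globalParam, ← Real.exp_add]
    congr 1; ring
  rw [linkProb, logisticProb, h]

/-! ### Joint law of the covariates and the network. -/

section JointLaw

variable {p n : ℕ} {Ω : Type*} [MeasurableSpace Ω] {P : Measure Ω}
  {ν : Measure (Fin p → ℝ)} {μ : ℝ} {γ : Fin p → ℝ} {Z : Pair n → Ω → (Fin p → ℝ)}
  {A : Pair n → Ω → Bool}

lemma linkProb_nonneg (μ : ℝ) (γ z : Fin p → ℝ) : 0 ≤ linkProb μ γ z := by
  unfold linkProb; positivity

lemma linkProb_le_one (μ : ℝ) (γ z : Fin p → ℝ) : linkProb μ γ z ≤ 1 := by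
  unfold linkProb
  rw [div_le_one (by positivity)]
  linarith

lemma continuous_linkProb (μ : ℝ) (γ : Fin p → ℝ) : Continuous (linkProb μ γ) := by
  unfold linkProb
  have : Continuous fun z : Fin p → ℝ => γ ⬝ᵥ z := by unfold dotProduct; fun_prop
  exact Continuous.div (by fun_prop) (by fun_prop) fun z => by positivity

/-- The conditional probability of the network `a` given the covariates `z`. -/
noncomputable def networkWeight (μ : ℝ) (γ : Fin p → ℝ) (a : Pair n → Bool)
    (z : Pair n → (Fin p → ℝ)) : ℝ :=
  ∏ e, bernoulliWeight (linkProb μ γ (z e)) (a e)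

lemma networkWeight_nonneg (a : Pair n → Bool) (z : Pair n → (Fin p → ℝ)) :
    0 ≤ networkWeight μ γ a z :=
  Finset.prod_nonneg fun _ _ => bernoulliWeight_nonneg (linkProb_nonneg _ _ _)
    (linkProb_le_one _ _ _) _

lemma networkWeight_le_one (a : Pair n → Bool) (z : Pair n → (Fin p → ℝ)) :
    networkWeight μ γ a z ≤ 1 := by
  refine Finset.prod_le_one (fun _ _ => bernoulliWeight_nonneg (linkProb_nonneg _ _ _)
    (linkProb_le_one _ _ _) _) fun e _ => ?_
  have h0 := linkProb_nonneg μ γ (z e)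
  have h1 := linkProb_le_one μ γ (z e)
  unfold bernoulliWeight
  split_ifs <;> linarith

lemma measurable_networkWeight (a : Pair n → Bool) :
    Measurable (networkWeight μ γ a : (Pair n → (Fin p → ℝ)) → ℝ) := by
  refine Finset.measurable_prod _ fun e _ => ?_
  have h := (continuous_linkProb μ γ).measurable.comp (measurable_pi_apply (X := fun _ : Pair n => Fin p → ℝ) e)
  unfold bernoulliWeight
  split_ifs
  · exact h
  · exact measurable_const.sub h

lemma IsModel.measurable_covariates (h : IsModel P ν μ γ Z A) :
    Measurable fun ω e => Z e ω :=
  measurable_pi_lambda _ h.measurable_Z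

lemma IsModel.measurableSet_network (h : IsModel P ν μ γ Z A) (a : Pair n → Bool) :
    MeasurableSet {ω | ∀ e, A e ω = a e} := by
  rw [Set.ofPred_forall]
  exact MeasurableSet.iInter fun e => h.measurable_A e (measurableSet_singleton (a e))

/-- Disintegration: integrating the conditional probability over events of the covariates is the
defining property of conditional expectation, and identifies the density on each network event. -/
lemma IsModel.map_restrict [IsProbabilityMeasure P] (h : IsModel P ν μ γ Z A) (a : Pair n → Bool) :
    (P.restrict {ω | ∀ e, A e ω = a e}).map (fun ω e => Z e ω) =
      (P.map fun ω e => Z e ω).withDensity fun z => ENNReal.ofReal (networkWeight μ γ a z) := by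
  have hZ := h.measurable_covariates
  have hA := h.measurableSet_network a
  ext s hs
  rw [Measure.map_apply hZ hs, Measure.restrict_apply (hZ hs), withDensity_apply _ hs,
    setLIntegral_map hs (measurable_networkWeight a).ennreal_ofReal hZ]
  have hint : Integrable (fun ω => networkWeight μ γ a (fun e => Z e ω)) P :=
    Integrable.of_bound ((measurable_networkWeight a).comp hZ).aestronglyMeasurable 1
      (ae_of_all _ fun ω => by
        rw [Real.norm_of_nonneg (networkWeight_nonneg _ _)]; exact networkWeight_le_one _ _)
  rw [← ofReal_integral_eq_lintegral_ofReal hint.integrableOn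
    (ae_of_all _ fun ω => networkWeight_nonneg _ _)]
  have h1 := setIntegral_condExp (μ := P) hZ.comap_le
    (f := {ω | ∀ e, A e ω = a e}.indicator fun _ => (1 : ℝ))
    ((integrable_const 1).indicator hA) (s := (fun ω e => Z e ω) ⁻¹' s) ⟨s, hs, rfl⟩
  have h2 : ∫ ω in (fun ω e => Z e ω) ⁻¹' s, networkWeight μ γ a (fun e => Z e ω) ∂P =
      P.real ((fun ω e => Z e ω) ⁻¹' s ∩ {ω | ∀ e, A e ω = a e}) := by
    rw [integral_indicator_const _ hA, smul_eq_mul, mul_one, measureReal_restrict_apply hA,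
      Set.inter_comm] at h1
    rw [← h1]
    refine integral_congr_ae (ae_restrict_of_ae ?_)
    filter_upwards [h.condProb_A a] with ω hω
    exact hω.symm
  rw [h2, ofReal_measureReal]

/-- Expectations of functions of the covariates and the network, in terms of the conditional law
of the network. -/
lemma IsModel.integral_comp [IsProbabilityMeasure P] (h : IsModel P ν μ γ Z A) {E : Type*} [NormedAddCommGroup E]
    [NormedSpace ℝ E] (f : (Pair n → (Fin p → ℝ)) → (Pair n → Bool) → E)
    (hf : ∀ a, StronglyMeasurable fun z => f z a)
    (hint : ∀ a, Integrable (fun ω => f (fun e => Z e ω) a) P) :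
    ∫ ω, f (fun e => Z e ω) (fun e => A e ω) ∂P =
      ∫ ω, ∑ a, networkWeight μ γ a (fun e => Z e ω) • f (fun e => Z e ω) a ∂P := by
  have hZ := h.measurable_covariates
  -- There are finitely many networks, so the integrand splits according to the realised one; each
  -- piece then depends on the covariates only.
  have hsplit : ∀ ω, f (fun e => Z e ω) (fun e => A e ω) =
      ∑ a, {ω | ∀ e, A e ω = a e}.indicator (fun ω => f (fun e => Z e ω) a) ω := fun ω => by
    rw [Finset.sum_eq_single (fun e => A e ω)]
    · simp
    · intro a _ ha
      rw [Set.indicator_of_notMem]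
      intro hmem
      exact ha (funext fun e => (hmem e).symm)
    · simp
  simp_rw [hsplit]
  rw [integral_finsetSum _ fun a _ => (hint a).indicator (h.measurableSet_network a),
    integral_finsetSum]
  · refine Finset.sum_congr rfl fun a _ => ?_
    rw [integral_indicator (h.measurableSet_network a)]
    rw [← integral_map (μ := P.restrict {ω | ∀ e, A e ω = a e}) (φ := fun ω e => Z e ω)
      (f := fun z => f z a) hZ.aemeasurable (hf a).aestronglyMeasurable, h.map_restrict a,
      integral_withDensity_eq_integral_toReal_smul (measurable_networkWeight a).ennreal_ofReal
        (ae_of_all _ fun _ => ENNReal.ofReal_lt_top), integral_map hZ.aemeasurable]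
    · simp_rw [ENNReal.toReal_ofReal (networkWeight_nonneg _ _)]
    · exact ((measurable_networkWeight a).ennreal_ofReal.ennreal_toReal.stronglyMeasurable.smul
        (hf a)).aestronglyMeasurable
  · intro a _
    refine (hint a).bdd_smul 1 ((measurable_networkWeight a).comp hZ).aestronglyMeasurable
      (ae_of_all _ fun ω => ?_)
    rw [Real.norm_of_nonneg (networkWeight_nonneg _ _)]
    exact networkWeight_le_one _ _

end JointLaw

/-! ### Weak law for bounded functions of the covariates. -/

section LawOfLargeNumbers

/-- Chebyshev's inequality for sums of a bounded function of i.i.d. variables. -/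
lemma measure_abs_sum_sub_ge_le {ι Ω E : Type*} [Fintype ι] [MeasurableSpace Ω] [MeasurableSpace E]
    {P : Measure Ω} [IsProbabilityMeasure P] {ν : Measure E} {X : ι → Ω → E}
    (hX : ∀ e, Measurable (X e)) (hind : iIndepFun X P) (hlaw : ∀ e, P.map (X e) = ν)
    {f : E → ℝ} (hf : Measurable f) {K η : ℝ} (hK : ∀ᵐ z ∂ν, |f z| ≤ K) (hη : 0 < η)
    (hN : 0 < Fintype.card ι) :
    P {ω | η * Fintype.card ι ≤ |∑ e, f (X e ω) - Fintype.card ι * ∫ z, f z ∂ν|} ≤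
      ENNReal.ofReal (K ^ 2 / η ^ 2 / Fintype.card ι) := by
  have hbd : ∀ e, ∀ᵐ ω ∂P, |f (X e ω)| ≤ K := fun e => by
    have := hK
    rw [← hlaw e] at this
    exact ae_of_ae_map (hX e).aemeasurable this
  have hmeas : ∀ e, Measurable (f ∘ X e) := fun e => hf.comp (hX e)
  have hLp : ∀ e, MemLp (f ∘ X e) 2 P := fun e =>
    MemLp.of_bound (hmeas e).aestronglyMeasurable K (hbd e)
  have hvar : variance (∑ e, f ∘ X e) P ≤ Fintype.card ι * K ^ 2 := by
    rw [IndepFun.variance_sum (fun e _ => hLp e)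
      fun e _ e' _ hee' => (hind.comp (fun _ => f) fun _ => hf).indepFun hee']
    calc _ ≤ ∑ _e : ι, K ^ 2 := by
          refine Finset.sum_le_sum fun e _ => ?_
          refine (variance_le_sq_of_bounded (a := -K) (b := K) ?_ (hmeas e).aemeasurable).trans
            (le_of_eq (by ring))
          filter_upwards [hbd e] with ω hω
          exact abs_le.1 hω
      _ = _ := by simp
  have hmean : ∫ ω, (∑ e, f ∘ X e) ω ∂P = Fintype.card ι * ∫ z, f z ∂ν := by
    simp only [Finset.sum_apply]
    rw [integral_finsetSum _ fun e _ => (hLp e).integrable (by norm_num)]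
    have : ∀ e, ∫ ω, (f ∘ X e) ω ∂P = ∫ z, f z ∂ν := fun e => by
      rw [← hlaw e, integral_map (hX e).aemeasurable hf.aestronglyMeasurable]
      rfl
    rw [Finset.sum_congr rfl fun e _ => this e]
    simp
  have hN' : (0 : ℝ) < Fintype.card ι := by exact_mod_cast hN
  have := meas_ge_le_variance_div_sq (memLp_finsetSum' Finset.univ fun e _ => hLp e)
    (mul_pos hη hN')
  rw [hmean] at this
  simp only [Finset.sum_apply, Function.comp] at this
  refine this.trans (ENNReal.ofReal_le_ofReal ?_)
  rw [div_le_iff₀ (by positivity)]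
  refine hvar.trans (le_of_eq ?_)
  field_simp

end LawOfLargeNumbers

/-! ### Design vectors and nondegeneracy of their Gram matrix. -/

section Augment

variable {p : ℕ}

/-- The design vector `(1, z)`. -/
def augment (z : Fin p → ℝ) : Fin (p + 1) → ℝ := Fin.cons 1 z

lemma measurable_augment_apply (j : Fin (p + 1)) : Measurable fun z : Fin p → ℝ => augment z j := by
  refine Fin.cases ?_ (fun k => ?_) j
  · simp [augment]
  · simpa [augment] using measurable_pi_apply k

lemma abs_augment_apply_le {c : ℝ} (hc : 1 ≤ c) {z : Fin p → ℝ} (hz : ∀ k, |z k| ≤ c)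
    (j : Fin (p + 1)) : |augment z j| ≤ c := by
  refine Fin.cases ?_ (fun k => ?_) j
  · simpa [augment] using hc
  · simpa [augment] using hz k

lemma norm_augment_le {c : ℝ} (hc : 1 ≤ c) {z : Fin p → ℝ} (hz : ∀ k, |z k| ≤ c) :
    ‖augment z‖ ≤ c :=
  (pi_norm_le_iff_of_nonneg (by linarith)).2 fun j => abs_augment_apply_le hc hz j

lemma augment_dotProduct_cons (z : Fin p → ℝ) (a : ℝ) (γ : Fin p → ℝ) :
    augment z ⬝ᵥ (Fin.cons a γ : Fin (p + 1) → ℝ) = a + γ ⬝ᵥ z := by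
  simp [augment, dotProduct, Fin.sum_univ_succ, mul_comm]

/-- Centring makes the second moment matrix of `(1, z)` block diagonal, with blocks `1` and the
covariance. -/
lemma sum_sum_mul_augment_pos {ν : Measure (Fin p → ℝ)} [IsProbabilityMeasure ν]
    (hν_centered : ∀ k, ∫ z, z k ∂ν = 0)
    (hν_posDef : (Matrix.of fun k l : Fin p => ∫ z, z k * z l ∂ν).PosDef)
    {u : Fin (p + 1) → ℝ} (hu : u ≠ 0) :
    0 < ∑ i, ∑ j, u i * u j * ∫ z, augment z i * augment z j ∂ν := by
  have h1 : ∑ i, ∑ j, u i * u j * ∫ z, augment z i * augment z j ∂ν =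
      u 0 ^ 2 + (fun k => u k.succ) ⬝ᵥ
        ((Matrix.of fun k l : Fin p => ∫ z, z k * z l ∂ν) *ᵥ fun k => u k.succ) := by
    simp only [Fin.sum_univ_succ, augment, Fin.cons_zero, Fin.cons_succ, mul_one, one_mul,
      hν_centered, mul_zero, Finset.sum_const_zero, integral_const, probReal_univ, smul_eq_mul,
      zero_add, add_zero, dotProduct, Matrix.mulVec, Matrix.of_apply, Finset.mul_sum]
    rw [sq]
    congr 1
    exact Finset.sum_congr rfl fun i _ => Finset.sum_congr rfl fun j _ => by ring
  rw [h1]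
  by_cases h0 : (fun k : Fin p => u k.succ) = 0
  · have : u 0 ≠ 0 := fun h => hu (funext fun j => by
      refine Fin.cases h (fun k => ?_) j
      exact congrFun h0 k)
    rw [h0, zero_dotProduct]
    positivity
  · have := hν_posDef.dotProduct_mulVec_pos h0
    rw [star_trivial] at this
    positivity

/-- The minimum over the compact unit sphere, extended by homogeneity. The sphere is empty exactly
when `d = 0`, where any `l` works. -/
lemma exists_le_sum_sum_mul {d : ℕ} (M : Fin d → Fin d → ℝ)
    (hM : ∀ u : Fin d → ℝ, u ≠ 0 → 0 < ∑ i, ∑ j, u i * u j * M i j) :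
    ∃ l > 0, ∀ u : Fin d → ℝ, l * ‖u‖ ^ 2 ≤ ∑ i, ∑ j, u i * u j * M i j := by
  have hcont : Continuous fun u : Fin d → ℝ => ∑ i, ∑ j, u i * u j * M i j := by fun_prop
  have hhom : ∀ u : Fin d → ℝ, u ≠ 0 → ∑ i, ∑ j, u i * u j * M i j =
      ‖u‖ ^ 2 * ∑ i, ∑ j, (‖u‖⁻¹ • u) i * (‖u‖⁻¹ • u) j * M i j := fun u hu => by
    have hn : ‖u‖ ≠ 0 := norm_ne_zero_iff.2 hu
    simp only [Finset.mul_sum, Pi.smul_apply, smul_eq_mul]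
    exact Finset.sum_congr rfl fun i _ => Finset.sum_congr rfl fun j _ => by field_simp
  rcases (Metric.sphere (0 : Fin d → ℝ) 1).eq_empty_or_nonempty with hemp | hne
  · refine ⟨1, one_pos, fun u => ?_⟩
    have : u = 0 := by
      by_contra hu
      have hn : ‖u‖ ≠ 0 := norm_ne_zero_iff.2 hu
      have : ‖u‖⁻¹ • u ∈ Metric.sphere (0 : Fin d → ℝ) 1 := by
        simp [norm_smul, hn]
      simp [hemp] at this
    subst this
    simp
  · obtain ⟨u₀, hu₀, hmin⟩ := (isCompact_sphere (0 : Fin d → ℝ) 1).exists_isMinOn hne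
      hcont.continuousOn
    have hu₀' : u₀ ≠ 0 := fun h => by simp [h] at hu₀
    refine ⟨_, hM u₀ hu₀', fun u => ?_⟩
    by_cases hu : u = 0
    · subst hu; simp
    · have hn : ‖u‖ ≠ 0 := norm_ne_zero_iff.2 hu
      rw [hhom u hu, mul_comm]
      have hmem : ‖u‖⁻¹ • u ∈ Metric.sphere (0 : Fin d → ℝ) 1 := by simp [norm_smul, hn]
      exact mul_le_mul_of_nonneg_left (hmin hmem) (sq_nonneg _)

lemma sum_dotProduct_sq {ι : Type*} [Fintype ι] {d : ℕ} (x : ι → Fin d → ℝ) (u : Fin d → ℝ) :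
    ∑ e, (x e ⬝ᵥ u) ^ 2 = ∑ i, ∑ j, u i * u j * ∑ e, x e i * x e j := by
  have h : ∀ e, (x e ⬝ᵥ u) ^ 2 = ∑ i, ∑ j, u i * u j * (x e i * x e j) := fun e => by
    rw [sq, dotProduct, Finset.sum_mul_sum]
    exact Finset.sum_congr rfl fun i _ => Finset.sum_congr rfl fun j _ => by ring
  simp_rw [h, Finset.mul_sum]
  rw [Finset.sum_comm]
  refine Finset.sum_congr rfl fun i _ => ?_
  rw [Finset.sum_comm]

/-- Entrywise errors `η N` move the quadratic form by at most `d² η N ‖u‖²`, which costs at most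
half of the lower bound. -/
lemma le_sum_dotProduct_sq_of_abs_sub_le {ι : Type*} [Fintype ι] {d : ℕ} {x : ι → Fin d → ℝ}
    {M : Fin d → Fin d → ℝ} {l η N : ℝ}
    (hM : ∀ u : Fin d → ℝ, l * ‖u‖ ^ 2 ≤ ∑ i, ∑ j, u i * u j * M i j) (hη : d * d * η ≤ l / 2)
    (hN : 0 ≤ N) (hx : ∀ i j, |∑ e, x e i * x e j - N * M i j| ≤ η * N) (u : Fin d → ℝ) :
    l / 2 * N * ‖u‖ ^ 2 ≤ ∑ e, (x e ⬝ᵥ u) ^ 2 := by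
  have h1 : |∑ i, ∑ j, u i * u j * (∑ e, x e i * x e j - N * M i j)| ≤
      d * d * η * (N * ‖u‖ ^ 2) := by
    calc _ ≤ ∑ i, ∑ j, |u i * u j * (∑ e, x e i * x e j - N * M i j)| :=
          (Finset.abs_sum_le_sum_abs _ _).trans
            (Finset.sum_le_sum fun i _ => Finset.abs_sum_le_sum_abs _ _)
      _ ≤ ∑ _i : Fin d, ∑ _j : Fin d, ‖u‖ * ‖u‖ * (η * N) := by
          refine Finset.sum_le_sum fun i _ => Finset.sum_le_sum fun j _ => ?_
          rw [abs_mul, abs_mul]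
          refine mul_le_mul ?_ (hx i j) (abs_nonneg _) (by positivity)
          exact mul_le_mul (norm_le_pi_norm u i) (norm_le_pi_norm u j) (abs_nonneg _)
            (norm_nonneg _)
      _ = _ := by simp; ring
  have h2 : ∑ i, ∑ j, u i * u j * (∑ e, x e i * x e j - N * M i j) =
      ∑ e, (x e ⬝ᵥ u) ^ 2 - N * ∑ i, ∑ j, u i * u j * M i j := by
    rw [sum_dotProduct_sq, Finset.mul_sum, ← Finset.sum_sub_distrib]
    refine Finset.sum_congr rfl fun i _ => ?_
    rw [Finset.mul_sum, ← Finset.sum_sub_distrib]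
    exact Finset.sum_congr rfl fun j _ => by ring
  rw [h2] at h1
  have h3 := neg_le_of_abs_le h1
  have h4 := mul_le_mul_of_nonneg_left (hM u) hN
  have h5 : d * d * η * (N * ‖u‖ ^ 2) ≤ l / 2 * (N * ‖u‖ ^ 2) := by gcongr
  linarith

end Augment

/-- Chebyshev for each of the `(p + 1)²` entries and a union bound. The constants are chosen before
the index type and the probability space, hence serve all `n`. -/
lemma exists_measure_gram_lt_le {p : ℕ} {ν : Measure (Fin p → ℝ)} [IsProbabilityMeasure ν]
    {c : ℝ} (hc : 1 ≤ c) (hν_bdd : ∀ᵐ z ∂ν, ∀ k, |z k| ≤ c)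
    (hν_centered : ∀ k, ∫ z, z k ∂ν = 0)
    (hν_posDef : (Matrix.of fun k l : Fin p => ∫ z, z k * z l ∂ν).PosDef) :
    ∃ l > 0, ∃ C : ℝ, ∀ {ι : Type _} {Ω : Type _} [Fintype ι] [MeasurableSpace Ω] (P : Measure Ω)
      [IsProbabilityMeasure P] (Z : ι → Ω → (Fin p → ℝ)), (∀ e, Measurable (Z e)) →
      iIndepFun Z P → (∀ e, P.map (Z e) = ν) → 0 < Fintype.card ι →
      P {ω | ¬ ∀ u, l * Fintype.card ι * ‖u‖ ^ 2 ≤ ∑ e, (augment (Z e ω) ⬝ᵥ u) ^ 2} ≤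
        ENNReal.ofReal (C / Fintype.card ι) := by
  obtain ⟨l, hl, hM⟩ := exists_le_sum_sum_mul
    (fun i j => ∫ z, augment z i * augment z j ∂ν)
    fun u hu => sum_sum_mul_augment_pos hν_centered hν_posDef hu
  set η := l / 2 / ((p + 1 : ℕ) * (p + 1 : ℕ)) with hη
  have hη0 : 0 < η := by positivity
  refine ⟨l / 2, by positivity, (p + 1 : ℕ) * (p + 1 : ℕ) * ((c * c) ^ 2 / η ^ 2),
    fun {ι Ω} _ _ P _ Z hZ hind hlaw hN => ?_⟩
  have hbad : ∀ i j : Fin (p + 1), P {ω | η * Fintype.card ι ≤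
      |∑ e, augment (Z e ω) i * augment (Z e ω) j -
        Fintype.card ι * ∫ z, augment z i * augment z j ∂ν|} ≤
      ENNReal.ofReal ((c * c) ^ 2 / η ^ 2 / Fintype.card ι) := fun i j => by
    refine measure_abs_sum_sub_ge_le hZ hind hlaw
      (f := fun z => augment z i * augment z j)
      ((measurable_augment_apply i).mul (measurable_augment_apply j)) ?_ hη0 hN
    filter_upwards [hν_bdd] with z hz
    rw [abs_mul]
    exact mul_le_mul (abs_augment_apply_le hc hz i) (abs_augment_apply_le hc hz j) (abs_nonneg _)
      (by linarith)
  calc _ ≤ P (⋃ i : Fin (p + 1), ⋃ j : Fin (p + 1), {ω | η * Fintype.card ι ≤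
        |∑ e, augment (Z e ω) i * augment (Z e ω) j -
          Fintype.card ι * ∫ z, augment z i * augment z j ∂ν|}) := by
        refine measure_mono fun ω hω => ?_
        by_contra hcon
        simp only [Set.mem_iUnion, Set.mem_ofPred_eq, not_exists, not_le] at hcon
        refine hω fun u => le_sum_dotProduct_sq_of_abs_sub_le hM ?_ (Nat.cast_nonneg _)
          (fun i j => (hcon i j).le) u
        rw [hη, mul_div_cancel₀]
        positivity
    _ ≤ ∑ _i : Fin (p + 1), ∑ _j : Fin (p + 1),
        ENNReal.ofReal ((c * c) ^ 2 / η ^ 2 / Fintype.card ι) :=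
        (measure_iUnion_fintype_le _ _).trans (Finset.sum_le_sum fun i _ =>
          (measure_iUnion_fintype_le _ _).trans (Finset.sum_le_sum fun j _ => hbad i j))
    _ = _ := by
        simp only [Finset.sum_const, Finset.card_univ, Fintype.card_fin, nsmul_eq_mul]
        rw [← mul_assoc, mul_div_assoc, ENNReal.ofReal_mul (by positivity),
          ENNReal.ofReal_mul (by positivity), ENNReal.ofReal_natCast]

/-! ### Measurability of inverse Hessians and influence coefficients. -/

section Measurability

/-- The formula `det⁻¹ * adjugate` also holds for singular matrices, both sides being zero, so
invertibility is not needed. -/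
lemma measurable_matrix_inv_apply {X m : Type*} [MeasurableSpace X] [Fintype m] [DecidableEq m]
    {F : X → Matrix m m ℝ} (hF : ∀ i j, Measurable fun x => F x i j) (i j : m) :
    Measurable fun x => (F x)⁻¹ i j := by
  have hF' : Measurable fun x => (fun i j => F x i j : m → m → ℝ) :=
    measurable_pi_lambda _ fun i => measurable_pi_lambda _ fun j => hF i j
  have hdet : Continuous fun f : m → m → ℝ => (Matrix.of f).det :=
    Continuous.matrix_det continuous_id
  have hadj : Continuous fun f : m → m → ℝ => (Matrix.of f).adjugate i j :=
    (Continuous.matrix_adjugate continuous_id).matrix_elem i j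
  have h : ∀ x, (F x)⁻¹ i j = (F x).det⁻¹ * (F x).adjugate i j := fun x => by
    rw [Matrix.inv_def, Ring.inverse_eq_inv', Matrix.smul_apply, smul_eq_mul]
  simp_rw [h]
  exact (hdet.measurable.comp hF').inv.mul (hadj.measurable.comp hF')

lemma weightedGram_apply {ι : Type*} [Fintype ι] [DecidableEq ι] {d : ℕ} (w : ι → ℝ)
    (x : ι → Fin d → ℝ) (i j : Fin d) : weightedGram w x i j = ∑ e, w e * x e i * x e j := by
  rw [weightedGram, Matrix.mul_apply]
  refine Finset.sum_congr rfl fun e _ => ?_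
  rw [Matrix.mul_diagonal]
  simp only [Matrix.transpose_apply, Matrix.of_apply]
  ring

lemma continuous_logisticVar {ε : ℝ} (hε : 0 ≤ ε) : Continuous (logisticVar ε) := by
  unfold logisticVar
  exact Continuous.div (by fun_prop) (by fun_prop) fun η => by positivity

lemma continuous_logisticProb {ε : ℝ} (hε : 0 ≤ ε) : Continuous (logisticProb ε) := by
  unfold logisticProb
  exact Continuous.div (by fun_prop) (by fun_prop) fun η => by positivity

variable {ι X : Type*} [Fintype ι] [DecidableEq ι] [MeasurableSpace X] {d : ℕ} {ε : ℝ}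
  {x : X → ι → Fin d → ℝ} {θ : X → Fin d → ℝ}

lemma measurable_hessian_inv_apply (hε : 0 ≤ ε) (hx : ∀ e j, Measurable fun s => x s e j)
    (hθ : ∀ j, Measurable fun s => θ s j) (i j : Fin d) :
    Measurable fun s => (hessian ε (x s) (θ s))⁻¹ i j := by
  refine measurable_matrix_inv_apply (fun i j => ?_) i j
  simp_rw [hessian, weightedGram_apply]
  refine Finset.measurable_sum _ fun e _ => ((Measurable.mul ?_ (hx e i)).mul (hx e j))
  refine (continuous_logisticVar hε).measurable.comp ?_
  exact Finset.measurable_sum _ fun j _ => (hx e j).mul (hθ j)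

lemma measurable_influence (hε : 0 ≤ ε) (hx : ∀ e j, Measurable fun s => x s e j)
    (hθ : ∀ j, Measurable fun s => θ s j) (k : Fin d) (e : ι) :
    Measurable fun s => influence ε (x s) (θ s) k e := by
  unfold influence
  refine Measurable.div ?_ (measurable_hessian_inv_apply hε hx hθ k k).sqrt
  refine Finset.measurable_sum _ fun j _ => (hx e j).mul ?_
  simpa using measurable_hessian_inv_apply hε hx hθ j k

end Measurability

/-! ### Second moment and characteristic function of the score. -/

section Model

variable {p n : ℕ} {Ω : Type*} [MeasurableSpace Ω] {P : Measure Ω}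
  {ν : Measure (Fin p → ℝ)} {ξ μ₀ : ℝ} {γ₀ : Fin p → ℝ} {Z : Pair n → Ω → (Fin p → ℝ)}
  {A : Pair n → Ω → Bool}

lemma IsModel.ae_forall_abs_le (h : IsModel P ν (globalParam n ξ μ₀) γ₀ Z A) {c : ℝ}
    (hν : ∀ᵐ z ∂ν, ∀ k, |z k| ≤ c) : ∀ᵐ ω ∂P, ∀ e k, |Z e ω k| ≤ c := by
  refine ae_all_iff.2 fun e => ?_
  rw [← h.law_Z e] at hν
  exact ae_of_ae_map (h.measurable_Z e).aemeasurable hν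

variable [IsProbabilityMeasure P]

/-- The conditional edge probabilities given the covariates `z`. -/
noncomputable def edgeProb (n : ℕ) (ξ : ℝ) (θ : Fin (p + 1) → ℝ) (z : Pair n → (Fin p → ℝ))
    (e : Pair n) : ℝ :=
  logisticProb ((n : ℝ) ^ (-ξ)) (augment (z e) ⬝ᵥ θ)

lemma measurable_edgeProb (θ : Fin (p + 1) → ℝ) (e : Pair n) :
    Measurable fun z : Pair n → (Fin p → ℝ) => edgeProb n ξ θ z e := by
  refine (continuous_logisticProb (by positivity)).measurable.comp ?_
  exact Finset.measurable_sum _ fun j _ =>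
    ((measurable_augment_apply j).comp (measurable_pi_apply e)).mul measurable_const

lemma edgeProb_nonneg (hn : 0 < n) (θ : Fin (p + 1) → ℝ) (z : Pair n → (Fin p → ℝ))
    (e : Pair n) : 0 ≤ edgeProb n ξ θ z e :=
  (logisticProb_pos (by positivity) _).le

lemma edgeProb_le_one (hn : 0 < n) (θ : Fin (p + 1) → ℝ) (z : Pair n → (Fin p → ℝ))
    (e : Pair n) : edgeProb n ξ θ z e ≤ 1 :=
  (logisticProb_lt_one (by positivity) _).le

lemma networkWeight_eq (hn : 0 < n) (a : Pair n → Bool) (z : Pair n → (Fin p → ℝ)) :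
    networkWeight (globalParam n ξ μ₀) γ₀ a z =
      ∏ e, bernoulliWeight (edgeProb n ξ (Fin.cons μ₀ γ₀) z e) (a e) := by
  simp only [networkWeight, linkProb_eq hn, edgeProb, augment_dotProduct_cons]

/-- Given the covariates, a score coordinate is a weighted sum of independent centred Bernoulli
variables, each of variance at most `e^B n^(-ξ)`. -/
lemma IsModel.integral_sq_sum_le (h : IsModel P ν (globalParam n ξ μ₀) γ₀ Z A) (hn : 0 < n)
    {c B : ℝ} (hZ : ∀ᵐ ω ∂P, ∀ e, ‖augment (Z e ω)‖ ≤ c)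
    (hB : ∀ᵐ ω ∂P, ∀ e, |augment (Z e ω) ⬝ᵥ (Fin.cons μ₀ γ₀ : Fin (p + 1) → ℝ)| ≤ B)
    (j : Fin (p + 1)) :
    Integrable (fun ω => score ((n : ℝ) ^ (-ξ)) (fun e => augment (Z e ω))
        (fun e => edgeValue (A e ω)) (Fin.cons μ₀ γ₀) j ^ 2) P ∧
    ∫ ω, score ((n : ℝ) ^ (-ξ)) (fun e => augment (Z e ω))
        (fun e => edgeValue (A e ω)) (Fin.cons μ₀ γ₀) j ^ 2 ∂P ≤
      Fintype.card (Pair n) * (c ^ 2 * (Real.exp B * (n : ℝ) ^ (-ξ))) := by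
  have hε : 0 < (n : ℝ) ^ (-ξ) := by positivity
  set θ₀ : Fin (p + 1) → ℝ := Fin.cons μ₀ γ₀ with hθ₀
  set f : (Pair n → (Fin p → ℝ)) → (Pair n → Bool) → ℝ := fun z a =>
    (∑ e, (edgeValue (a e) - edgeProb n ξ θ₀ z e) * augment (z e) j) ^ 2 with hf
  have hfm : ∀ a, Measurable fun z => f z a := fun a => by
    refine (Finset.measurable_sum _ fun e _ => Measurable.mul ?_ ?_).pow_const 2
    · exact measurable_const.sub (measurable_edgeProb _ e)
    · exact (measurable_augment_apply j).comp (measurable_pi_apply e)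
  have hbd : ∀ᵐ ω ∂P, ∀ a, ‖f (fun e => Z e ω) a‖ ≤ (Fintype.card (Pair n) * c) ^ 2 := by
    filter_upwards [hZ] with ω hω a
    rw [hf, norm_pow]
    gcongr
    calc _ ≤ ∑ _e : Pair n, c := by
          refine (norm_sum_le _ _).trans (Finset.sum_le_sum fun e _ => ?_)
          have h0 := edgeProb_nonneg (ξ := ξ) hn θ₀ (fun e => Z e ω) e
          have h1 := edgeProb_le_one (ξ := ξ) hn θ₀ (fun e => Z e ω) e
          have h2 := (norm_le_pi_norm (augment (Z e ω)) j).trans (hω e)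
          rw [norm_mul]
          refine (mul_le_of_le_one_left (norm_nonneg _) ?_).trans h2
          rw [Real.norm_eq_abs, abs_le, edgeValue]
          split_ifs <;> constructor <;> linarith
      _ = _ := by simp
  have hmeasZ := h.measurable_covariates
  have hscore : ∀ ω, score ((n : ℝ) ^ (-ξ)) (fun e => augment (Z e ω))
      (fun e => edgeValue (A e ω)) θ₀ j ^ 2 = f (fun e => Z e ω) (fun e => A e ω) := fun ω => by
    simp only [hf, score, edgeProb]
  simp_rw [hscore]
  refine ⟨?_, ?_⟩
  · refine Integrable.of_bound (C := (Fintype.card (Pair n) * c) ^ 2) ?_ ?_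
    · have hA : ∀ e, Measurable fun ω => edgeValue (A e ω) := fun e =>
        (measurable_of_countable edgeValue).comp (h.measurable_A e)
      have hE : ∀ e, Measurable fun ω => edgeProb n ξ θ₀ (fun e => Z e ω) e := fun e => by
        have h1 : Measurable ((fun z => edgeProb n ξ θ₀ z e) ∘ fun ω e => Z e ω) :=
          Measurable.comp (measurable_edgeProb θ₀ e) hmeasZ
        exact h1
      have hx : ∀ e, Measurable fun ω => augment (Z e ω) j := fun e =>
        (measurable_augment_apply j).comp (h.measurable_Z e)
      have hm : Measurable fun ω => (∑ e, (edgeValue (A e ω) -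
          edgeProb n ξ θ₀ (fun e => Z e ω) e) * augment (Z e ω) j) ^ 2 :=
        (Finset.measurable_sum _ fun e _ => ((hA e).sub (hE e)).mul (hx e)).pow_const 2
      exact hm.aestronglyMeasurable
    · filter_upwards [hbd] with ω hω
      exact hω fun e => A e ω
  · have hint : ∀ a, Integrable (fun ω => f (fun e => Z e ω) a) P := fun a =>
      Integrable.of_bound ((hfm a).comp hmeasZ).aestronglyMeasurable _
        (hbd.mono fun ω hω => hω a)
    have := h.integral_comp f (fun a => (hfm a).stronglyMeasurable) hint
    refine (le_of_eq this).trans ?_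
    have hval : ∀ ω, ∑ a, networkWeight (globalParam n ξ μ₀) γ₀ a (fun e => Z e ω) •
        f (fun e => Z e ω) a = ∑ e, augment (Z e ω) j ^ 2 *
          logisticVar ((n : ℝ) ^ (-ξ)) (augment (Z e ω) ⬝ᵥ θ₀) := fun ω => by
      simp only [networkWeight_eq hn, ← hθ₀, smul_eq_mul, hf]
      rw [sum_prod_bernoulliWeight_mul_sq]
      exact Finset.sum_congr rfl fun e _ => by rw [edgeProb, logisticProb_mul_one_sub hε]
    simp_rw [hval]
    have hle : ∀ᵐ ω ∂P, ∑ e, augment (Z e ω) j ^ 2 *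
          logisticVar ((n : ℝ) ^ (-ξ)) (augment (Z e ω) ⬝ᵥ θ₀) ≤
        Fintype.card (Pair n) * (c ^ 2 * (Real.exp B * (n : ℝ) ^ (-ξ))) := by
      filter_upwards [hZ, hB] with ω hω hω'
      calc _ ≤ ∑ _e : Pair n, c ^ 2 * (Real.exp B * (n : ℝ) ^ (-ξ)) := by
            refine Finset.sum_le_sum fun e _ => ?_
            have h2 := (norm_le_pi_norm (augment (Z e ω)) j).trans (hω e)
            refine mul_le_mul ?_ (logisticVar_le hε (hω' e)) (logisticVar_pos hε _).le
              (sq_nonneg _)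
            rw [← sq_abs]
            exact pow_le_pow_left₀ (abs_nonneg _) h2 2
        _ = _ := by simp
    calc _ ≤ ∫ _ω, (Fintype.card (Pair n) * (c ^ 2 * (Real.exp B * (n : ℝ) ^ (-ξ))) : ℝ) ∂P :=
          integral_mono_of_nonneg (ae_of_all _ fun ω => Finset.sum_nonneg fun e _ =>
            mul_nonneg (sq_nonneg _) (logisticVar_pos hε _).le) (integrable_const _) hle
      _ = _ := by simp

/-- Markov's inequality for each squared coordinate; the sup norm is attained at one of the `p + 1`
coordinates. -/
lemma IsModel.measure_norm_score_sq_ge_le (h : IsModel P ν (globalParam n ξ μ₀) γ₀ Z A)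
    (hn : 0 < n) {c B : ℝ} (hZ : ∀ᵐ ω ∂P, ∀ e, ‖augment (Z e ω)‖ ≤ c)
    (hB : ∀ᵐ ω ∂P, ∀ e, |augment (Z e ω) ⬝ᵥ (Fin.cons μ₀ γ₀ : Fin (p + 1) → ℝ)| ≤ B)
    {s : ℝ} (hs : 0 < s) :
    P {ω | s ≤ ‖score ((n : ℝ) ^ (-ξ)) (fun e => augment (Z e ω))
        (fun e => edgeValue (A e ω)) (Fin.cons μ₀ γ₀)‖ ^ 2} ≤
      ENNReal.ofReal ((p + 1 : ℕ) * (Fintype.card (Pair n) *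
        (c ^ 2 * (Real.exp B * (n : ℝ) ^ (-ξ))) / s)) := by
  have key : ∀ j, P {ω | s ≤ score ((n : ℝ) ^ (-ξ)) (fun e => augment (Z e ω))
        (fun e => edgeValue (A e ω)) (Fin.cons μ₀ γ₀) j ^ 2} ≤
      ENNReal.ofReal (Fintype.card (Pair n) *
        (c ^ 2 * (Real.exp B * (n : ℝ) ^ (-ξ))) / s) := fun j => by
    obtain ⟨hint, hle⟩ := h.integral_sq_sum_le hn hZ hB j
    have := mul_meas_ge_le_integral_of_nonneg (ae_of_all _ fun ω => sq_nonneg _) hint s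
    rw [← ofReal_measureReal]
    refine ENNReal.ofReal_le_ofReal ?_
    rw [le_div_iff₀ hs, mul_comm]
    exact this.trans hle
  calc _ ≤ P (⋃ j, {ω | s ≤ score ((n : ℝ) ^ (-ξ)) (fun e => augment (Z e ω))
        (fun e => edgeValue (A e ω)) (Fin.cons μ₀ γ₀) j ^ 2}) := by
        refine measure_mono fun ω hω => ?_
        obtain ⟨j, -, hj⟩ := Finset.exists_mem_eq_sup' Finset.univ_nonempty
          (fun j => ‖score ((n : ℝ) ^ (-ξ)) (fun e => augment (Z e ω))
            (fun e => edgeValue (A e ω)) (Fin.cons μ₀ γ₀) j‖)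
        refine Set.mem_iUnion.2 ⟨j, ?_⟩
        rw [Set.mem_ofPred_eq] at hω ⊢
        have h1 : ‖score ((n : ℝ) ^ (-ξ)) (fun e => augment (Z e ω))
            (fun e => edgeValue (A e ω)) (Fin.cons μ₀ γ₀)‖ ≤
            ‖score ((n : ℝ) ^ (-ξ)) (fun e => augment (Z e ω))
            (fun e => edgeValue (A e ω)) (Fin.cons μ₀ γ₀) j‖ := by
          rw [← hj]
          refine (pi_norm_le_iff_of_nonempty _).2 fun i => ?_
          exact Finset.le_sup' (fun j => ‖score ((n : ℝ) ^ (-ξ)) (fun e => augment (Z e ω))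
            (fun e => edgeValue (A e ω)) (Fin.cons μ₀ γ₀) j‖) (Finset.mem_univ i)
        refine hω.trans ?_
        rw [← sq_abs (score _ _ _ _ j)]
        exact pow_le_pow_left₀ (norm_nonneg _) h1 2
    _ ≤ _ := (measure_iUnion_fintype_le _ _).trans (Finset.sum_le_sum fun j _ => key j)
    _ = _ := by
        rw [Finset.sum_const, Finset.card_univ, Fintype.card_fin, nsmul_eq_mul,
          ENNReal.ofReal_mul (Nat.cast_nonneg _), ENNReal.ofReal_natCast]

/-- The exceptional set need not be measurable, so its measurable hull is used. -/
lemma integral_le_add_of_le_off {g : Ω → ℝ} (hg0 : ∀ ω, 0 ≤ g ω) (hg2 : ∀ ω, g ω ≤ 2) {η : ℝ}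
    (hη : 0 ≤ η) {s : Set Ω} (hs : ∀ᵐ ω ∂P, ω ∉ s → g ω ≤ η) :
    ∫ ω, g ω ∂P ≤ η + 2 * P.real s := by
  have hm := measurableSet_toMeasurable P s
  calc _ ≤ ∫ ω, (η + (toMeasurable P s).indicator (fun _ => (2 : ℝ)) ω) ∂P := by
        refine integral_mono_of_nonneg (ae_of_all _ hg0)
          ((integrable_const _).add ((integrable_const _).indicator hm)) ?_
        filter_upwards [hs] with ω hω
        by_cases hmem : ω ∈ toMeasurable P s
        · rw [Set.indicator_of_mem hmem]
          linarith [hg2 ω]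
        · rw [Set.indicator_of_notMem hmem, add_zero]
          exact hω fun hs => hmem (subset_toMeasurable P s hs)
    _ = η + 2 * P.real s := by
        rw [integral_add (integrable_const _) ((integrable_const _).indicator hm),
          integral_indicator_const _ hm]
        simp [measureReal_def, measure_toMeasurable, mul_comm]

/-- The characteristic function of the normalised score is close to the Gaussian one. -/
lemma IsModel.norm_integral_exp_sub_le (h : IsModel P ν (globalParam n ξ μ₀) γ₀ Z A)
    (hξ : 0 ≤ ξ) (hn : 0 < n) {c B l t : ℝ} (hl : 0 < l)
    (hZ : ∀ᵐ ω ∂P, ∀ e, ‖augment (Z e ω)‖ ≤ c)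
    (hB : ∀ᵐ ω ∂P, ∀ e, |augment (Z e ω) ⬝ᵥ (Fin.cons μ₀ γ₀ : Fin (p + 1) → ℝ)| ≤ B)
    (hc : 0 ≤ c)
    (ht : |t| * ((p + 1 : ℕ) * c / √(logisticVarLower B * ((n : ℝ) ^ (-ξ) * l))) ≤ 1)
    (k : Fin (p + 1)) :
    ‖∫ ω, Complex.exp ((t * (∑ e, (edgeValue (A e ω) - logisticProb ((n : ℝ) ^ (-ξ))
        (augment (Z e ω) ⬝ᵥ (Fin.cons μ₀ γ₀ : Fin (p + 1) → ℝ))) *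
          influence ((n : ℝ) ^ (-ξ)) (fun e => augment (Z e ω)) (Fin.cons μ₀ γ₀) k e) : ℝ) *
            Complex.I) ∂P -
        Complex.exp ((-t ^ 2 / 2 : ℝ))‖ ≤
      4 * (|t| * ((p + 1 : ℕ) * c / √(logisticVarLower B * ((n : ℝ) ^ (-ξ) * l)))) * t ^ 2 +
        2 * P.real {ω | ¬ ∀ u, l * ‖u‖ ^ 2 ≤ ∑ e, (augment (Z e ω) ⬝ᵥ u) ^ 2} := by
  have hε : 0 < (n : ℝ) ^ (-ξ) := by positivity
  have hε1 : (n : ℝ) ^ (-ξ) ≤ 1 :=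
    Real.rpow_le_one_of_one_le_of_nonpos (by exact_mod_cast hn) (by linarith)
  set ε := (n : ℝ) ^ (-ξ) with hεdef
  set θ₀ : Fin (p + 1) → ℝ := Fin.cons μ₀ γ₀ with hθ₀
  set C : (Pair n → (Fin p → ℝ)) → Pair n → ℝ := fun z e =>
    influence ε (fun e => augment (z e)) θ₀ k e with hC
  have hCm : ∀ e, Measurable fun z => C z e := fun e =>
    measurable_influence hε.le (x := fun (z : Pair n → (Fin p → ℝ)) e => augment (z e))
      (θ := fun _ => θ₀)
      (fun e j => (measurable_augment_apply j).comp (measurable_pi_apply e))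
      (fun _ => measurable_const) k e
  set f : (Pair n → (Fin p → ℝ)) → (Pair n → Bool) → ℂ := fun z a =>
    Complex.exp ((t * (∑ e, (edgeValue (a e) - edgeProb n ξ θ₀ z e) * C z e) : ℝ) *
      Complex.I) with hf
  have hfm : ∀ a, Measurable fun z => f z a := fun a => by
    have h1 : Measurable fun z => t * (∑ e, (edgeValue (a e) - edgeProb n ξ θ₀ z e) * C z e) :=
      (Finset.measurable_sum _ fun e _ =>
        (measurable_const.sub (measurable_edgeProb _ e)).mul (hCm e)).const_mul t
    exact ((Complex.measurable_ofReal.comp h1).mul_const _).cexp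
  have hint : ∀ a, Integrable (fun ω => f (fun e => Z e ω) a) P := fun a =>
    Integrable.of_bound ((hfm a).comp h.measurable_covariates).aestronglyMeasurable 1
      (ae_of_all _ fun ω => (Complex.norm_exp_ofReal_mul_I _).le)
  -- The conditional characteristic function of the normalised score given the covariates.
  set F : Ω → ℂ := fun ω => ∏ e, bernoulliCharFun (edgeProb n ξ θ₀ (fun e => Z e ω) e)
    (t * C (fun e => Z e ω) e) with hF
  have hval : ∀ ω, ∑ a, networkWeight (globalParam n ξ μ₀) γ₀ a (fun e => Z e ω) •
      f (fun e => Z e ω) a = F ω := fun ω => by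
    simp only [hF, bernoulliCharFun]
    rw [← sum_prod_pi_bool (fun e b => (bernoulliWeight (edgeProb n ξ θ₀ (fun e => Z e ω) e) b : ℂ) *
      Complex.exp ((t * C (fun e => Z e ω) e *
        (edgeValue b - edgeProb n ξ θ₀ (fun e => Z e ω) e) : ℝ) * Complex.I))]
    refine Finset.sum_congr rfl fun a _ => ?_
    rw [networkWeight_eq hn, Finset.prod_mul_distrib, ← Complex.exp_sum, Complex.real_smul,
      Complex.ofReal_prod, ← Finset.sum_mul, ← Complex.ofReal_sum]
    simp only [hf]
    rw [Finset.mul_sum]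
    congr 4
    exact Finset.sum_congr rfl fun e _ => by ring
  have hFm : AEStronglyMeasurable F P := by
    have : F = fun ω => ∑ a, networkWeight (globalParam n ξ μ₀) γ₀ a (fun e => Z e ω) •
      f (fun e => Z e ω) a := funext fun ω => (hval ω).symm
    rw [this]
    refine Measurable.aestronglyMeasurable (Finset.measurable_sum _ fun a _ => ?_)
    exact ((measurable_networkWeight a).comp h.measurable_covariates).smul
      ((hfm a).comp h.measurable_covariates)
  have hF1 : ∀ ω, ‖F ω‖ ≤ 1 := fun ω => by
    rw [hF, norm_prod]
    exact Finset.prod_le_one (fun _ _ => norm_nonneg _) fun e _ =>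
      norm_bernoulliCharFun_le (edgeProb_nonneg hn _ _ _) (edgeProb_le_one hn _ _ _) _
  have hFi : Integrable F P := Integrable.of_bound hFm 1 (ae_of_all _ hF1)
  have hcomp := h.integral_comp f (fun a => (hfm a).stronglyMeasurable) hint
  simp_rw [hval] at hcomp
  have hstart : ∫ ω, Complex.exp ((t * (∑ e, (edgeValue (A e ω) - logisticProb ε
        (augment (Z e ω) ⬝ᵥ θ₀)) *
          influence ε (fun e => augment (Z e ω)) θ₀ k e) : ℝ) * Complex.I) ∂P =
      ∫ ω, F ω ∂P := hcomp
  rw [hstart]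
  have hconst : Complex.exp ((-t ^ 2 / 2 : ℝ)) =
      ∫ _ω, Complex.exp ((-t ^ 2 / 2 : ℝ)) ∂P := by simp
  rw [hconst, ← integral_sub hFi (integrable_const _)]
  -- On the event of a large Gram matrix the deterministic bound applies; elsewhere two numbers of
  -- modulus at most one differ by at most 2.
  refine (norm_integral_le_integral_norm _).trans
    (integral_le_add_of_le_off (fun _ => norm_nonneg _) (fun ω => ?_) (by positivity) ?_)
  · refine (norm_sub_le _ _).trans ?_
    have : ‖Complex.exp ((-t ^ 2 / 2 : ℝ))‖ ≤ 1 := by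
      rw [← Complex.ofReal_exp, Complex.norm_real, Real.norm_of_nonneg (Real.exp_pos _).le,
        Real.exp_le_one_iff]
      nlinarith [sq_nonneg t]
    linarith [hF1 ω]
  · filter_upwards [hZ, hB] with ω hω hω' hgram
    have hgram : ∀ u, l * ‖u‖ ^ 2 ≤ ∑ e, (augment (Z e ω) ⬝ᵥ u) ^ 2 := not_not.1 hgram
    refine norm_prod_bernoulliCharFun_sub_le _ _ (edgeProb_nonneg hn _ _) (edgeProb_le_one hn _ _)
      (fun e => abs_influence_le hε hε1 hl hgram hω hω' k e) ?_ ht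
    refine Eq.trans (Finset.sum_congr rfl fun e _ => ?_)
      (sum_influence_sq hε hε1 hl hgram hω' k)
    rw [edgeProb, logisticProb_mul_one_sub hε]

end Model

/-! ### Translation of the network likelihood into logistic regression. -/

section Likelihood

variable {p n : ℕ}

/-- The parameter `(μ†, γ)` as a single vector. -/
def paramVec (θ : ℝ × (Fin p → ℝ)) : Fin (p + 1) → ℝ := Fin.cons θ.1 θ.2

lemma augment_dotProduct_paramVec (z : Fin p → ℝ) (θ : ℝ × (Fin p → ℝ)) :
    augment z ⬝ᵥ paramVec θ = θ.1 + θ.2 ⬝ᵥ z :=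
  augment_dotProduct_cons _ _ _

lemma paramVec_add_smul (θ u : ℝ × (Fin p → ℝ)) (t : ℝ) :
    paramVec (θ + t • u) = paramVec θ + t • paramVec u := by
  funext j
  refine Fin.cases ?_ (fun k => ?_) j <;> simp [paramVec]

lemma dist_le_norm_paramVec_sub (θ θ' : ℝ × (Fin p → ℝ)) :
    dist θ θ' ≤ ‖paramVec θ - paramVec θ'‖ := by
  rw [Prod.dist_eq]
  refine max_le ?_ ((dist_pi_le_iff (norm_nonneg _)).2 fun k => ?_)
  · have := norm_le_pi_norm (paramVec θ - paramVec θ') 0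
    simpa [paramVec, Real.dist_eq] using this
  · have := norm_le_pi_norm (paramVec θ - paramVec θ') k.succ
    simpa [paramVec, Real.dist_eq] using this

lemma norm_paramVec_le (θ : ℝ × (Fin p → ℝ)) : ‖paramVec θ‖ ≤ ‖θ‖ := by
  refine (pi_norm_le_iff_of_nonneg (norm_nonneg _)).2 fun j => ?_
  refine Fin.cases ?_ (fun k => ?_) j
  · simpa [paramVec] using norm_fst_le θ
  · simpa [paramVec] using (norm_le_pi_norm θ.2 k).trans (norm_snd_le θ)

lemma negLogLik_eq_logisticLoss (ξ : ℝ) (z : Pair n → (Fin p → ℝ)) (a : Pair n → Bool)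
    (θ : ℝ × (Fin p → ℝ)) :
    negLogLik ξ z a θ = logisticLoss ((n : ℝ) ^ (-ξ)) (fun e => augment (z e))
      (fun e => edgeValue (a e)) (paramVec θ) := by
  simp only [negLogLik, logisticLoss, augment_dotProduct_paramVec, edgeValue, mul_add,
    Finset.sum_sub_distrib, Finset.sum_add_distrib, ← Finset.sum_mul]
  have : ∑ e, (θ.2 ⬝ᵥ z e) * (if a e then (1 : ℝ) else 0) =
      ∑ e, (if a e then (1 : ℝ) else 0) * (θ.2 ⬝ᵥ z e) :=
    Finset.sum_congr rfl fun e _ => mul_comm _ _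
  rw [this]
  ring

lemma hasDerivAt_logisticLoss_line {ι : Type*} [Fintype ι] {d : ℕ} {ε : ℝ} (hε : 0 < ε)
    (x : ι → Fin d → ℝ) (y : ι → ℝ) (θ u : Fin d → ℝ) :
    HasDerivAt (fun t : ℝ => logisticLoss ε x y (θ + t • u)) (-(score ε x y θ ⬝ᵥ u)) 0 := by
  have hlin : ∀ e, HasDerivAt (fun t : ℝ => x e ⬝ᵥ (θ + t • u)) (x e ⬝ᵥ u) 0 := fun e => by
    have : (fun t : ℝ => x e ⬝ᵥ (θ + t • u)) = fun t => x e ⬝ᵥ θ + t * (x e ⬝ᵥ u) := by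
      funext t
      rw [dotProduct_add, dotProduct_smul, smul_eq_mul]
    rw [this]
    simpa using ((hasDerivAt_id (0 : ℝ)).mul_const (x e ⬝ᵥ u)).const_add (x e ⬝ᵥ θ)
  have h : ∀ e, HasDerivAt (fun t : ℝ => Real.log (1 + ε * Real.exp (x e ⬝ᵥ (θ + t • u))) -
      y e * (x e ⬝ᵥ (θ + t • u)))
      (logisticProb ε (x e ⬝ᵥ θ) * (x e ⬝ᵥ u) - y e * (x e ⬝ᵥ u)) 0 := fun e => by
    have h1 := hasDerivAt_log_one_add_mul_exp hε (x e ⬝ᵥ (θ + (0 : ℝ) • u))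
    refine ((h1.comp (0 : ℝ) (hlin e)).sub ((hlin e).const_mul (y e))).congr_deriv ?_
    simp
  have hsum := HasDerivAt.fun_sum (u := Finset.univ) fun e _ => h e
  refine hsum.congr_deriv ?_
  rw [score_dotProduct, ← Finset.sum_neg_distrib]
  exact Finset.sum_congr rfl fun e _ => by ring

lemma score_eq_zero_of_isLocalMin (hn : 0 < n) {ξ : ℝ} {z : Pair n → (Fin p → ℝ)}
    {a : Pair n → Bool} {θ : ℝ × (Fin p → ℝ)} (h : IsLocalMin (negLogLik ξ z a) θ) :
    score ((n : ℝ) ^ (-ξ)) (fun e => augment (z e)) (fun e => edgeValue (a e)) (paramVec θ) =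
      0 := by
  have hε : 0 < (n : ℝ) ^ (-ξ) := by positivity
  funext j
  set u : ℝ × (Fin p → ℝ) :=
    ((Pi.single j 1 : Fin (p + 1) → ℝ) 0, fun k => (Pi.single j 1 : Fin (p + 1) → ℝ) k.succ)
  have hu : paramVec u = Pi.single j 1 := by
    funext i
    refine Fin.cases rfl (fun k => rfl) i
  have hcont : Tendsto (fun t : ℝ => θ + t • u) (𝓝 0) (𝓝 θ) := by
    have : Continuous fun t : ℝ => θ + t • u := by fun_prop
    simpa using this.tendsto 0
  have hmin : IsLocalMin (fun t : ℝ => logisticLoss ((n : ℝ) ^ (-ξ)) (fun e => augment (z e))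
      (fun e => edgeValue (a e)) (paramVec θ + t • Pi.single j 1)) 0 := by
    filter_upwards [hcont.eventually h] with t ht
    rw [negLogLik_eq_logisticLoss, negLogLik_eq_logisticLoss, paramVec_add_smul, hu] at ht
    simpa using ht
  have := hmin.hasDerivAt_eq_zero (hasDerivAt_logisticLoss_line hε _ _ _ _)
  simpa using this

lemma card_pair (n : ℕ) : Fintype.card (Pair n) = n.choose 2 := by
  rw [Fintype.card_subtype, Fintype.card_product_filter_lt, Fintype.card_fin]

lemma plugInHessian_eq (ξ : ℝ) (z : Pair n → (Fin p → ℝ)) (θ : ℝ × (Fin p → ℝ)) :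
    plugInHessian z (globalParam n ξ θ.1) θ.2 = ((n.choose 2 : ℕ) : ℝ)⁻¹ •
      hessian ((n : ℝ) ^ (-ξ)) (fun e => augment (z e)) (paramVec θ) := by
  -- For `n = 0` the prefactor is `0⁻¹ = 0` and both sides vanish.
  rcases Nat.eq_zero_or_pos n with rfl | hn
  · simp [plugInHessian]
  · have hn' : (0 : ℝ) < n := by exact_mod_cast hn
    rw [plugInHessian, hessian, weightedGram]
    have hw : (fun e => Real.exp (globalParam n ξ θ.1 + θ.2 ⬝ᵥ z e) /
        (1 + Real.exp (globalParam n ξ θ.1 + θ.2 ⬝ᵥ z e)) ^ 2) =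
        fun e => logisticVar ((n : ℝ) ^ (-ξ)) (augment (z e) ⬝ᵥ paramVec θ) := by
      funext e
      have h : Real.exp (globalParam n ξ θ.1 + θ.2 ⬝ᵥ z e) =
          (n : ℝ) ^ (-ξ) * Real.exp (θ.1 + θ.2 ⬝ᵥ z e) := by
        rw [Real.rpow_def_of_pos hn', globalParam, ← Real.exp_add]
        congr 1; ring
      rw [h, logisticVar, augment_dotProduct_paramVec]
    rw [hw]
    rfl

end Likelihood

/-- On the event that the score is small and the Gram matrix is large, the studentised estimator is
close to the normalised score. -/
lemma studentized_close {p n : ℕ} {ξ c B l r₀ η : ℝ} (hξ : 0 ≤ ξ) (hn : 0 < n.choose 2)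
    (hc : 0 ≤ c) (hl : 0 < l) {z : Pair n → (Fin p → ℝ)} {a : Pair n → Bool}
    {Θ : Set (ℝ × (Fin p → ℝ))} {θ₀ θ : ℝ × (Fin p → ℝ)}
    (hz : ∀ e, ‖augment (z e)‖ ≤ c) (hB₀ : ∀ e, |augment (z e) ⬝ᵥ paramVec θ₀| ≤ B)
    (hB : ∀ e, |augment (z e) ⬝ᵥ paramVec θ| ≤ B)
    (hgram : ∀ u, l * Fintype.card (Pair n) * ‖u‖ ^ 2 ≤ ∑ e, (augment (z e) ⬝ᵥ u) ^ 2)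
    (hball : Metric.ball θ₀ r₀ ⊆ Θ) (hr₀ : 0 < r₀) (hr₁ : r₀ ≤ 1)
    (hmin : IsMinOn (negLogLik ξ z a) Θ θ)
    (hscore : ‖score ((n : ℝ) ^ (-ξ)) (fun e => augment (z e)) (fun e => edgeValue (a e))
      (paramVec θ₀)‖ ^ 2 ≤ η * (((n : ℝ) ^ (-ξ) * (n.choose 2 : ℕ)) *
        √((n : ℝ) ^ (-ξ) * (n.choose 2 : ℕ))))
    (hη : (2 * (p + 1 : ℕ) / logisticVarLower B / l) ^ 2 * η /
      √((n : ℝ) ^ (-ξ) * (n.choose 2 : ℕ)) < r₀ ^ 2) :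
    (plugInHessian z (globalParam n ξ θ.1) θ.2).PosDef ∧ ∀ k : Fin p,
      |√((n.choose 2 : ℕ) : ℝ) * ((θ.2 k - θ₀.2 k) /
          √((plugInHessian z (globalParam n ξ θ.1) θ.2)⁻¹ k.succ k.succ)) -
        ∑ e, (edgeValue (a e) - logisticProb ((n : ℝ) ^ (-ξ)) (augment (z e) ⬝ᵥ paramVec θ₀)) *
          influence ((n : ℝ) ^ (-ξ)) (fun e => augment (z e)) (paramVec θ₀) k.succ e| ≤
      2 * ((p + 1 : ℕ) * c) ^ 3 * Real.exp ((p + 1 : ℕ) * c) * Real.exp B /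
        √(logisticVarLower B) / √l * (2 * (p + 1 : ℕ) / logisticVarLower B / l) ^ 2 * η := by
  have hn0 : 0 < n := Nat.pos_of_ne_zero fun h => by simp [h] at hn
  have hε : 0 < (n : ℝ) ^ (-ξ) := by positivity
  have hε1 : (n : ℝ) ^ (-ξ) ≤ 1 :=
    Real.rpow_le_one_of_one_le_of_nonpos (by exact_mod_cast hn0) (by linarith)
  rw [card_pair] at hgram
  have hN : (0 : ℝ) < (n.choose 2 : ℕ) := by exact_mod_cast hn
  have hcard : (Fintype.card (Pair n) : ℝ) = (n.choose 2 : ℕ) := by rw [card_pair]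
  rw [plugInHessian_eq]
  set ε := (n : ℝ) ^ (-ξ)
  set N : ℝ := ((n.choose 2 : ℕ) : ℝ) with hNdef
  set x : Pair n → Fin (p + 1) → ℝ := fun e => augment (z e) with hx
  set S := score ε x (fun e => edgeValue (a e)) (paramVec θ₀) with hS
  set δ := paramVec θ - paramVec θ₀ with hδ
  set K₀ := 2 * (p + 1 : ℕ) / logisticVarLower B / l with hK₀
  have hm := logisticVarLower_pos B
  have hτ : 0 < ε * N := by positivity
  have hθ₀ : θ₀ ∈ Θ := hball (Metric.mem_ball_self hr₀)
  have hle : logisticLoss ε x (fun e => edgeValue (a e)) (paramVec θ) ≤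
      logisticLoss ε x (fun e => edgeValue (a e)) (paramVec θ₀) := by
    have := hmin hθ₀
    simp only [Set.mem_ofPred_eq, negLogLik_eq_logisticLoss] at this
    exact this
  have h1 : ‖δ‖ ≤ K₀ * (‖S‖ / (ε * N)) := by
    refine (norm_sub_le_of_logisticLoss_le hε hε1 (by positivity : 0 < l * N) hgram hB₀ hB
      hle).trans (le_of_eq ?_)
    rw [hK₀]
    field_simp
    rfl
  -- The score threshold `η τ^(3/2)` is tailored to this: `‖δ‖ ≤ K₀ ‖S‖ / τ` gives `√τ ‖δ‖² ≤ K₀²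
  -- η`, the order of the linearisation error.
  have h2 : √(ε * N) * ‖δ‖ ^ 2 ≤ K₀ ^ 2 * η := by
    have hsq := Real.mul_self_sqrt hτ.le
    have hs := Real.sqrt_pos.2 hτ
    calc √(ε * N) * ‖δ‖ ^ 2 ≤ √(ε * N) * (K₀ * (‖S‖ / (ε * N))) ^ 2 := by gcongr
      _ = √(ε * N) * K₀ ^ 2 / (ε * N) ^ 2 * ‖S‖ ^ 2 := by ring
      _ ≤ √(ε * N) * K₀ ^ 2 / (ε * N) ^ 2 * (η * ((ε * N) * √(ε * N))) := by gcongr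
      _ = K₀ ^ 2 * η * ((√(ε * N) * √(ε * N)) * (ε * N) / (ε * N) ^ 2) := by ring
      _ = K₀ ^ 2 * η := by
          rw [hsq, ← sq, div_self (by positivity), mul_one]
  -- The minimizer falls into the ball around the truth, hence is a local minimum with vanishing
  -- score.
  have h3 : ‖δ‖ < r₀ := by
    refine lt_of_pow_lt_pow_left₀ 2 hr₀.le (lt_of_le_of_lt ?_ hη)
    rw [le_div_iff₀ (Real.sqrt_pos.2 hτ)]
    linarith
  have hloc : IsLocalMin (negLogLik ξ z a) θ :=
    hmin.isLocalMin (mem_of_superset (Metric.isOpen_ball.mem_nhds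
      ((dist_le_norm_paramVec_sub θ θ₀).trans_lt h3)) hball)
  have hsc := score_eq_zero_of_isLocalMin hn0 hloc
  have hmain := fun k => abs_studentized_sub_le hε hε1 (by positivity : 0 < l * N) hgram hc hz hB₀
    hsc (h3.le.trans hr₁) k
  have hPD := (hmain 0).1
  refine ⟨hPD.smul (by positivity), fun k => ?_⟩
  have hk := (hmain k.succ).2
  -- The normalisation of the plug-in Hessian multiplies its inverse by `N`, which cancels the
  -- factor `√N` of the statistic.
  have hinv : ((N⁻¹ • hessian ε x (paramVec θ))⁻¹) k.succ k.succ =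
      N * (hessian ε x (paramVec θ))⁻¹ k.succ k.succ := by
    have hdet : IsUnit (hessian ε x (paramVec θ)).det :=
      (Matrix.isUnit_iff_isUnit_det _).1 hPD.isUnit
    have := Matrix.inv_smul' _ (Units.mk0 N⁻¹ (by positivity)) hdet
    have h4 : (N⁻¹ • hessian ε x (paramVec θ))⁻¹ = N • (hessian ε x (paramVec θ))⁻¹ := by
      simpa [Units.smul_def] using this
    rw [h4, Matrix.smul_apply, smul_eq_mul]
  have hT : √N * ((θ.2 k - θ₀.2 k) / √((N⁻¹ • hessian ε x (paramVec θ))⁻¹ k.succ k.succ)) =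
      (paramVec θ k.succ - paramVec θ₀ k.succ) /
        √((hessian ε x (paramVec θ))⁻¹ k.succ k.succ) := by
    have hV := Real.sqrt_pos.2 (inv_apply_pos hPD k.succ)
    have hsN := Real.sqrt_pos.2 hN
    rw [hinv, Real.sqrt_mul hN.le]
    simp only [paramVec, Fin.cons_succ]
    field_simp
  rw [hT]
  refine hk.trans ?_
  rw [hcard]
  have h5 : ε * N / √(ε * (l * N)) * ‖paramVec θ - paramVec θ₀‖ ^ 2 ≤ (√l)⁻¹ * (K₀ ^ 2 * η) := by
    have h6 : ε * N / √(ε * (l * N)) = (√l)⁻¹ * √(ε * N) := by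
      rw [show ε * (l * N) = l * (ε * N) by ring, Real.sqrt_mul hl.le]
      have hsq := Real.mul_self_sqrt hτ.le
      have hs := Real.sqrt_pos.2 hτ
      have hsl := Real.sqrt_pos.2 hl
      rw [div_eq_iff (by positivity)]
      calc ε * N = √(ε * N) * √(ε * N) := hsq.symm
        _ = _ := by field_simp
    rw [h6, mul_assoc]
    gcongr
  calc _ ≤ 2 * ((p + 1 : ℕ) * c) ^ 3 * Real.exp ((p + 1 : ℕ) * c) * Real.exp B /
        √(logisticVarLower B) * ((√l)⁻¹ * (K₀ ^ 2 * η)) := by gcongr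
    _ = _ := by ring

/-! ### From closeness in probability to convergence in distribution. -/

section Convergence

lemma aemeasurable_plugInHessian_inv_apply {p n : ℕ} {ξ : ℝ} {Ω : Type*} [MeasurableSpace Ω]
    {P : Measure Ω} {z : Ω → Pair n → (Fin p → ℝ)} {θ : Ω → ℝ × (Fin p → ℝ)}
    (hz : AEMeasurable z P) (hθ : AEMeasurable θ P) (i j : Fin (p + 1)) :
    AEMeasurable (fun ω => (plugInHessian (z ω) (globalParam n ξ (θ ω).1) (θ ω).2)⁻¹ i j) P := by
  have hx : ∀ e j, Measurable fun s : (Pair n → (Fin p → ℝ)) × (ℝ × (Fin p → ℝ)) =>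
      augment (s.1 e) j := fun e j =>
    (measurable_augment_apply j).comp ((measurable_pi_apply e).comp measurable_fst)
  have hv : ∀ j, Measurable fun s : (Pair n → (Fin p → ℝ)) × (ℝ × (Fin p → ℝ)) =>
      paramVec s.2 j := fun j => by
    refine Fin.cases ?_ (fun k => ?_) j
    · exact measurable_fst.comp measurable_snd
    · exact (measurable_pi_apply k).comp (measurable_snd.comp measurable_snd)
  have hw : ∀ e, Measurable fun s : (Pair n → (Fin p → ℝ)) × (ℝ × (Fin p → ℝ)) =>
      logisticVar ((n : ℝ) ^ (-ξ)) (augment (s.1 e) ⬝ᵥ paramVec s.2) := fun e => by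
    have h1 : Measurable fun s : (Pair n → (Fin p → ℝ)) × (ℝ × (Fin p → ℝ)) =>
        augment (s.1 e) ⬝ᵥ paramVec s.2 :=
      Finset.measurable_sum _ fun j _ => (hx e j).mul (hv j)
    have hε : 0 ≤ (n : ℝ) ^ (-ξ) := by positivity
    exact (continuous_logisticVar hε).measurable.comp h1
  have hm : Measurable fun s : (Pair n → (Fin p → ℝ)) × (ℝ × (Fin p → ℝ)) =>
      (plugInHessian s.1 (globalParam n ξ s.2.1) s.2.2)⁻¹ i j := by
    refine measurable_matrix_inv_apply (fun i j => ?_) _ _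
    simp_rw [plugInHessian_eq, Matrix.smul_apply, hessian, weightedGram_apply, smul_eq_mul]
    exact (Finset.measurable_sum _ fun e _ =>
      (((hw e).mul (hx e i)).mul (hx e j))).const_mul _
  have h := hm.comp_aemeasurable (hz.prodMk hθ)
  exact h

lemma tendsto_measure_of_iff_off {Ω : ℕ → Type*} [∀ n, MeasurableSpace (Ω n)]
    {P : ∀ n, Measure (Ω n)} {S S' bad : ∀ n, Set (Ω n)} {a : ENNReal}
    (hS : Tendsto (fun n => P n (S n)) atTop (𝓝 a))
    (hbad : Tendsto (fun n => P n (bad n)) atTop (𝓝 0))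
    (h : ∀ᶠ n in atTop, ∀ ω, ω ∉ bad n → (ω ∈ S n ↔ ω ∈ S' n)) :
    Tendsto (fun n => P n (S' n)) atTop (𝓝 a) := by
  have hlow : Tendsto (fun n => P n (S n) - P n (bad n)) atTop (𝓝 a) := by
    simpa using ENNReal.Tendsto.sub hS hbad (Or.inr ENNReal.zero_ne_top)
  have hup : Tendsto (fun n => P n (S n) + P n (bad n)) atTop (𝓝 a) := by
    simpa using hS.add hbad
  refine tendsto_of_tendsto_of_tendsto_of_le_of_le' hlow hup ?_ ?_
  · filter_upwards [h] with n hn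
    rw [tsub_le_iff_right]
    refine (measure_mono fun ω hω => ?_).trans (measure_union_le (S' n) (bad n))
    by_cases hb : ω ∈ bad n
    · exact Or.inr hb
    · exact Or.inl ((hn ω hb).1 hω)
  · filter_upwards [h] with n hn
    refine (measure_mono fun ω hω => ?_).trans (measure_union_le (S n) (bad n))
    by_cases hb : ω ∈ bad n
    · exact Or.inr hb
    · exact Or.inl ((hn ω hb).2 hω)

lemma tendsto_measureReal_zero {Ω : ℕ → Type*} [∀ n, MeasurableSpace (Ω n)]
    {P : ∀ n, Measure (Ω n)} {bad : ∀ n, Set (Ω n)}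
    (hbad : Tendsto (fun n => P n (bad n)) atTop (𝓝 0)) :
    Tendsto (fun n => (P n).real (bad n)) atTop (𝓝 0) := by
  have := (ENNReal.tendsto_toReal ENNReal.zero_ne_top).comp hbad
  rwa [ENNReal.toReal_zero] at this

variable {Ω : ℕ → Type*} [∀ n, MeasurableSpace (Ω n)] {P : ∀ n, Measure (Ω n)}
  [∀ n, IsProbabilityMeasure (P n)]

lemma norm_exp_sub_exp_le (t x y : ℝ) :
    ‖Complex.exp ((t * x : ℝ) * Complex.I) - Complex.exp ((t * y : ℝ) * Complex.I)‖ ≤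
      |t| * |x - y| := by
  have h1 : Complex.exp ((t * x : ℝ) * Complex.I) - Complex.exp ((t * y : ℝ) * Complex.I) =
      Complex.exp ((t * y : ℝ) * Complex.I) *
        (Complex.exp (Complex.I * ((t * (x - y) : ℝ) : ℂ)) - 1) := by
    rw [mul_sub, ← Complex.exp_add, mul_one]
    congr 2
    push_cast
    ring
  rw [h1, norm_mul, Complex.norm_exp_ofReal_mul_I, one_mul]
  refine Real.norm_exp_I_mul_ofReal_sub_one_le.trans (le_of_eq ?_)
  rw [Real.norm_eq_abs, abs_mul]

/-- A sequence that is close in probability to one whose characteristic functions converge to the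
standard Gaussian one converges in distribution to a standard Gaussian. -/
lemma tendstoInDistribution_gaussianReal_of_close {T U : ∀ n, Ω n → ℝ} {K : ℝ} (hK : 0 ≤ K)
    (hT : ∀ n, AEMeasurable (T n) (P n)) (hU : ∀ n, AEMeasurable (U n) (P n))
    (hclose : ∀ η : ℝ, 0 < η → η ≤ 1 →
      Tendsto (fun n => P n {ω | ¬ |T n ω - U n ω| ≤ K * η}) atTop (𝓝 0))
    (hchar : ∀ t : ℝ, Tendsto (fun n => ∫ ω, Complex.exp ((t * U n ω : ℝ) * Complex.I) ∂(P n))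
      atTop (𝓝 (Complex.exp ((-t ^ 2 / 2 : ℝ))))) :
    TendstoInDistribution T atTop (id : ℝ → ℝ) P (gaussianReal 0 1) := by
  refine ⟨hT, aemeasurable_id, ?_⟩
  refine ProbabilityMeasure.tendsto_iff_tendsto_charFun.2 fun t => ?_
  have hlim : charFun (Measure.map id (gaussianReal 0 1)) t = Complex.exp ((-t ^ 2 / 2 : ℝ)) := by
    rw [Measure.map_id, charFun_gaussianReal]
    congr 1
    push_cast
    ring
  have hcf : ∀ n, charFun ((P n).map (T n)) t =
      ∫ ω, Complex.exp ((t * T n ω : ℝ) * Complex.I) ∂(P n) := fun n => by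
    rw [charFun_apply_real, integral_map (hT n)
      (by fun_prop)]
    simp
  simp only [ProbabilityMeasure.coe_mk, hlim, hcf]
  have hint : ∀ {V : ∀ n, Ω n → ℝ}, (∀ n, AEMeasurable (V n) (P n)) → ∀ n,
      Integrable (fun ω => Complex.exp ((t * V n ω : ℝ) * Complex.I)) (P n) := fun {V} hV n => by
    refine Integrable.of_bound (C := 1) ?_
      (ae_of_all _ fun ω => (Complex.norm_exp_ofReal_mul_I _).le)
    exact ((Complex.measurable_ofReal.comp_aemeasurable
      ((hV n).const_mul t)).mul_const _).cexp.aestronglyMeasurable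
  have hdiff : Tendsto (fun n => ∫ ω, Complex.exp ((t * T n ω : ℝ) * Complex.I) ∂(P n) -
      ∫ ω, Complex.exp ((t * U n ω : ℝ) * Complex.I) ∂(P n)) atTop (𝓝 0) := by
    rw [Metric.tendsto_atTop']
    intro ε hε
    obtain ⟨η, hη0, hη1, hη⟩ : ∃ η : ℝ, 0 < η ∧ η ≤ 1 ∧ |t| * (K * η) ≤ ε / 4 := by
      -- The summand `1` in the denominator covers the case `|t| * K = 0`.
      refine ⟨min 1 (ε / 4 / (|t| * K + 1)), by positivity, min_le_left _ _, ?_⟩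
      have h0 : 0 ≤ |t| * K := by positivity
      calc |t| * (K * min 1 (ε / 4 / (|t| * K + 1)))
          = |t| * K * min 1 (ε / 4 / (|t| * K + 1)) := by ring
        _ ≤ (|t| * K + 1) * (ε / 4 / (|t| * K + 1)) := by
            gcongr
            · linarith
            · exact min_le_right _ _
        _ = ε / 4 := by field_simp
    have hev := (tendsto_measureReal_zero (hclose η hη0 hη1)).eventually_lt_const
      (show (0 : ℝ) < ε / 4 by positivity)
    obtain ⟨n₀, hn₀⟩ := eventually_atTop.1 hev
    refine ⟨n₀, fun n hn => ?_⟩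
    rw [dist_zero_right, ← integral_sub (hint hT n) (hint hU n)]
    have := integral_le_add_of_le_off (P := P n)
      (g := fun ω => ‖Complex.exp ((t * T n ω : ℝ) * Complex.I) -
        Complex.exp ((t * U n ω : ℝ) * Complex.I)‖)
      (fun _ => norm_nonneg _) (fun ω => ?_) (η := |t| * (K * η)) (by positivity)
      (s := {ω | ¬ |T n ω - U n ω| ≤ K * η}) (ae_of_all _ fun ω hω => ?_)
    · refine lt_of_le_of_lt ((norm_integral_le_integral_norm _).trans this) ?_
      linarith [hn₀ n hn.le]
    · refine (norm_sub_le _ _).trans ?_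
      rw [Complex.norm_exp_ofReal_mul_I, Complex.norm_exp_ofReal_mul_I]
      norm_num
    · refine (norm_exp_sub_exp_le t _ _).trans ?_
      have : |T n ω - U n ω| ≤ K * η := not_not.1 hω
      gcongr
  simpa using hdiff.add (hchar t)

/-- Portmanteau: the boundary of the interval lies in `{-q, q}`, a null set of the Gaussian law. -/
lemma tendsto_measure_abs_le_of_tendstoInDistribution {T : ∀ n, Ω n → ℝ}
    (hT : TendstoInDistribution T atTop (id : ℝ → ℝ) P (gaussianReal 0 1)) (q : ℝ) :
    Tendsto (fun n => P n {ω | |T n ω| ≤ q}) atTop (𝓝 (gaussianReal 0 1 (Set.Icc (-q) q))) := by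
  have hfr : gaussianReal 0 1 (frontier (Set.Icc (-q) q)) = 0 := by
    have := nullSingletonClass_gaussianReal (μ := 0) (v := 1) one_ne_zero
    refine measure_mono_null (t := {-q, q}) ?_ (Set.Finite.measure_zero (by simp) _)
    rcases le_total (-q) q with h | h
    · rw [frontier_Icc h]
    · intro x hx
      have hx' : x ∈ Set.Icc (-q) q := isClosed_Icc.frontier_subset hx
      exact Or.inr (le_antisymm hx'.2 (h.trans hx'.1))
  have := ProbabilityMeasure.tendsto_measure_of_null_frontier_of_tendsto' hT.tendsto
    (E := Set.Icc (-q) q) (by simpa using hfr)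
  simp only [ProbabilityMeasure.coe_mk, Measure.map_id] at this
  refine this.congr fun n => ?_
  rw [Measure.map_apply_of_aemeasurable (hT.forall_aemeasurable n) measurableSet_Icc]
  congr 1
  ext ω
  simp [abs_le]

end Convergence

section Score

lemma IsModel.measurable_normalizedScore {p n : ℕ} {ξ μ : ℝ} {γ : Fin p → ℝ} {Ω : Type*}
    [MeasurableSpace Ω] {P : Measure Ω} {ν : Measure (Fin p → ℝ)}
    {Z : Pair n → Ω → (Fin p → ℝ)} {A : Pair n → Ω → Bool} (h : IsModel P ν μ γ Z A)
    (θ : Fin (p + 1) → ℝ) (k : Fin (p + 1)) :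
    Measurable fun ω => ∑ e, (edgeValue (A e ω) -
      logisticProb ((n : ℝ) ^ (-ξ)) (augment (Z e ω) ⬝ᵥ θ)) *
        influence ((n : ℝ) ^ (-ξ)) (fun e => augment (Z e ω)) θ k e := by
  have hx : ∀ e j, Measurable fun ω => augment (Z e ω) j := fun e j =>
    (measurable_augment_apply j).comp (h.measurable_Z e)
  have hA : ∀ e, Measurable fun ω => edgeValue (A e ω) := fun e =>
    (measurable_of_countable edgeValue).comp (h.measurable_A e)
  have hdot : ∀ e, Measurable fun ω => augment (Z e ω) ⬝ᵥ θ := fun e =>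
    Finset.measurable_sum _ fun j _ => (hx e j).mul measurable_const
  have hε : 0 ≤ (n : ℝ) ^ (-ξ) := by positivity
  have hP : ∀ e, Measurable fun ω => logisticProb ((n : ℝ) ^ (-ξ)) (augment (Z e ω) ⬝ᵥ θ) :=
    fun e => (continuous_logisticProb hε).measurable.comp (hdot e)
  have hI : ∀ e, Measurable fun ω =>
      influence ((n : ℝ) ^ (-ξ)) (fun e => augment (Z e ω)) θ k e := fun e =>
    measurable_influence (x := fun ω e => augment (Z e ω)) (θ := fun _ => θ) hε hx
      (fun _ => measurable_const) k e
  exact Finset.measurable_sum _ fun e _ => ((hA e).sub (hP e)).mul (hI e)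

end Score

/-! ### Growth of the effective sample size. -/

section Rate

lemma tendsto_choose_two : Tendsto (fun n : ℕ => ((n.choose 2 : ℕ) : ℝ)) atTop atTop := by
  refine tendsto_atTop_mono' _ ?_ (tendsto_atTop_add_const_right _ (-1)
    (tendsto_natCast_atTop_atTop (R := ℝ)))
  filter_upwards [eventually_ge_atTop 2] with n hn
  rw [Nat.cast_choose_two]
  have : (2 : ℝ) ≤ n := by exact_mod_cast hn
  nlinarith

/-- Since `n (n - 1) / 2 ≥ n² / 4` for `n ≥ 2`, the product is at least `n^(2 - ξ) / 4`. This is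
where `ξ < 2` enters. -/
lemma tendsto_rpow_mul_choose_two {ξ : ℝ} (hξ : ξ < 2) :
    Tendsto (fun n : ℕ => (n : ℝ) ^ (-ξ) * ((n.choose 2 : ℕ) : ℝ)) atTop atTop := by
  have h1 : Tendsto (fun n : ℕ => (n : ℝ) ^ (2 - ξ) * (1 / 4)) atTop atTop :=
    ((tendsto_rpow_atTop (by linarith)).comp tendsto_natCast_atTop_atTop).atTop_mul_const
      (by norm_num)
  refine tendsto_atTop_mono' _ ?_ h1
  filter_upwards [eventually_ge_atTop 2] with n hn
  have hn' : (2 : ℝ) ≤ n := by exact_mod_cast hn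
  have hpos : (0 : ℝ) < n := by linarith
  rw [Nat.cast_choose_two, sub_eq_neg_add, Real.rpow_add hpos, Real.rpow_two, mul_assoc]
  gcongr
  nlinarith

end Rate

end ERC

/-! ### Assembly of the theorem. -/

theorem mainTheorem4 {p : ℕ} (ξ M : ℝ) (hξ_nonneg : 0 ≤ ξ) (hξ_lt : ξ < 2)
    (Γ : Set (Fin p → ℝ)) (hΓ_compact : IsCompact Γ) (hΓ_convex : Convex ℝ Γ)
    (μ₀ : ℝ) (γ₀ : Fin p → ℝ) (hθ₀ : (μ₀, γ₀) ∈ interior (ERC.paramSpace M Γ))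
    -- the common law of the covariates: bounded, centered, nondegenerate
    (ν : Measure (Fin p → ℝ)) [IsProbabilityMeasure ν]
    (hν_bdd : ∃ c : ℝ, ∀ᵐ z ∂ν, ∀ k, |z k| ≤ c)
    (hν_centered : ∀ k, ∫ z, z k ∂ν = 0)
    (hν_posDef : (Matrix.of fun k l : Fin p => ∫ z, z k * z l ∂ν).PosDef)
    -- for each `n`, a network on `n` nodes with covariates
    {Ω : ℕ → Type*} [∀ n, MeasurableSpace (Ω n)]
    (P : ∀ n, Measure (Ω n)) [∀ n, IsProbabilityMeasure (P n)]
    (Z : ∀ n, ERC.Pair n → Ω n → (Fin p → ℝ)) (A : ∀ n, ERC.Pair n → Ω n → Bool)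
    (hmodel : ∀ n, ERC.IsModel (P n) ν (ERC.globalParam n ξ μ₀) γ₀ (Z n) (A n))
    -- the maximum likelihood estimator
    (θhat : ∀ n, Ω n → ℝ × (Fin p → ℝ)) (hθhat_meas : ∀ n, AEMeasurable (θhat n) (P n))
    (hθhat : ∀ n, ∀ᵐ ω ∂(P n), θhat n ω ∈ ERC.paramSpace M Γ ∧
      IsMinOn (ERC.negLogLik ξ (fun e => Z n e ω) (fun e => A n e ω)) (ERC.paramSpace M Γ)
        (θhat n ω))
    -- the plug-in Hessian at the estimator
    (Shat : ∀ n, Ω n → Matrix (Fin (p + 1)) (Fin (p + 1)) ℝ)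
    (hShat : ∀ n ω, Shat n ω = ERC.plugInHessian (fun e => Z n e ω)
      (ERC.globalParam n ξ (θhat n ω).1) (θhat n ω).2) :
    -- with probability tending to one, the plug-in Hessian is positive definite
    Tendsto (fun n => P n {ω | (Shat n ω).PosDef}) atTop (𝓝 1) ∧
    ∀ k : Fin p,
      -- componentwise asymptotic normality
      TendstoInDistribution
        (fun n ω => √((n.choose 2 : ℕ) : ℝ) *
          (((θhat n ω).2 k - γ₀ k) / √((Shat n ω)⁻¹ k.succ k.succ)))
        atTop (id : ℝ → ℝ) P (gaussianReal 0 1) ∧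
      -- asymptotic coverage of the resulting confidence intervals
      ∀ q : ℝ, 0 ≤ q →
        Tendsto (fun n => P n {ω | |(θhat n ω).2 k - γ₀ k| ≤
            q * √((Shat n ω)⁻¹ k.succ k.succ / ((n.choose 2 : ℕ) : ℝ))})
          atTop (𝓝 (gaussianReal 0 1 (Set.Icc (-q) q))) := by
  -- uniform bounds on the covariates and the linear predictors
  obtain ⟨c, hc1, hc⟩ : ∃ c : ℝ, 1 ≤ c ∧ ∀ᵐ z ∂ν, ∀ k, |z k| ≤ c := by
    obtain ⟨c, hc⟩ := hν_bdd
    exact ⟨max c 1, le_max_right _ _, hc.mono fun z hz k => (hz k).trans (le_max_left _ _)⟩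
  have hc0 : 0 ≤ c := by linarith
  obtain ⟨R, hR⟩ : ∃ R : ℝ, ∀ θ ∈ ERC.paramSpace M Γ, ‖θ‖ ≤ R :=
    (isCompact_Icc.prod hΓ_compact).isBounded.exists_norm_le
  set B : ℝ := (p + 1 : ℕ) * (c * R) with hBdef
  have hpred : ∀ {z : Fin p → ℝ} {θ : ℝ × (Fin p → ℝ)}, ‖ERC.augment z‖ ≤ c →
      θ ∈ ERC.paramSpace M Γ → |ERC.augment z ⬝ᵥ ERC.paramVec θ| ≤ B := by
    intro z θ hz hθ
    refine (ERC.abs_dotProduct_le _ _).trans ?_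
    have := (ERC.norm_paramVec_le θ).trans (hR θ hθ)
    rw [hBdef]
    gcongr
  have hmem₀ : (μ₀, γ₀) ∈ ERC.paramSpace M Γ := interior_subset hθ₀
  obtain ⟨r₀, hr₀, hr₁, hball⟩ : ∃ r₀ : ℝ, 0 < r₀ ∧ r₀ ≤ 1 ∧
      Metric.ball (μ₀, γ₀) r₀ ⊆ ERC.paramSpace M Γ := by
    obtain ⟨r, hr, hsub⟩ := Metric.mem_nhds_iff.1 (mem_interior_iff_mem_nhds.1 hθ₀)
    exact ⟨min r 1, by positivity, min_le_right _ _,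
      (Metric.ball_subset_ball (min_le_left _ _)).trans hsub⟩
  obtain ⟨l, hl, C, hgram⟩ := ERC.exists_measure_gram_lt_le hc1 hc hν_centered hν_posDef
  have hm := ERC.logisticVarLower_pos B
  have hZ : ∀ n, ∀ᵐ ω ∂(P n), ∀ e, ‖ERC.augment (Z n e ω)‖ ≤ c := fun n => by
    filter_upwards [(hmodel n).ae_forall_abs_le hc] with ω hω e
    exact ERC.norm_augment_le hc1 (hω e)
  have hB₀ : ∀ n, ∀ᵐ ω ∂(P n), ∀ e,
      |ERC.augment (Z n e ω) ⬝ᵥ (Fin.cons μ₀ γ₀ : Fin (p + 1) → ℝ)| ≤ B := fun n => by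
    filter_upwards [hZ n] with ω hω e
    exact hpred (hω e) hmem₀
  have hNtop := ERC.tendsto_choose_two
  have hτtop := ERC.tendsto_rpow_mul_choose_two hξ_lt
  set N : ℕ → ℝ := fun n => ((n.choose 2 : ℕ) : ℝ) with hN
  set τ : ℕ → ℝ := fun n => (n : ℝ) ^ (-ξ) * ((n.choose 2 : ℕ) : ℝ) with hτ
  have hcard : ∀ n, (Fintype.card (ERC.Pair n) : ℝ) = N n := fun n => by rw [ERC.card_pair]
  have hev : ∀ᶠ n : ℕ in atTop, 0 < n.choose 2 := by
    filter_upwards [eventually_ge_atTop 2] with n hn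
    exact Nat.choose_pos hn
  -- the Gram matrix of the design is nondegenerate
  set badG : ∀ n, Set (Ω n) := fun n => {ω | ¬ ∀ u, l * Fintype.card (ERC.Pair n) * ‖u‖ ^ 2 ≤
    ∑ e, (ERC.augment (Z n e ω) ⬝ᵥ u) ^ 2} with hbadG
  have hG : Tendsto (fun n => P n (badG n)) atTop (𝓝 0) := by
    have h1 : Tendsto (fun n => ENNReal.ofReal (C / N n)) atTop (𝓝 0) := by
      simpa using ENNReal.tendsto_ofReal (hNtop.const_div_atTop C)
    refine tendsto_of_tendsto_of_tendsto_of_le_of_le' tendsto_const_nhds h1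
      (Eventually.of_forall fun _ => zero_le) ?_
    filter_upwards [hev] with n hn
    rw [← hcard n]
    exact hgram (P n) (Z n) (hmodel n).measurable_Z (hmodel n).indep_Z (hmodel n).law_Z
      (by rwa [ERC.card_pair])
  -- the score is of the right order
  set sc : ∀ n, Ω n → Fin (p + 1) → ℝ := fun n ω => ERC.score ((n : ℝ) ^ (-ξ))
    (fun e => ERC.augment (Z n e ω)) (fun e => ERC.edgeValue (A n e ω))
    (ERC.paramVec (μ₀, γ₀)) with hsc
  have hS : ∀ η : ℝ, 0 < η →
      Tendsto (fun n => P n {ω | η * (τ n * √(τ n)) ≤ ‖sc n ω‖ ^ 2}) atTop (𝓝 0) := by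
    intro η hη
    -- Markov's inequality at level `η τ^(3/2)` against a second moment of order `τ` leaves a
    -- probability of order `τ^(-1/2)`.
    have h1 : Tendsto (fun n => ENNReal.ofReal
        ((p + 1 : ℕ) * c ^ 2 * Real.exp B / η / √(τ n))) atTop (𝓝 0) := by
      simpa using ENNReal.tendsto_ofReal
        ((Real.tendsto_sqrt_atTop.comp hτtop).const_div_atTop
          ((p + 1 : ℕ) * c ^ 2 * Real.exp B / η))
    refine tendsto_of_tendsto_of_tendsto_of_le_of_le' tendsto_const_nhds h1
      (Eventually.of_forall fun _ => zero_le) ?_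
    filter_upwards [eventually_gt_atTop 0, hτtop.eventually_gt_atTop 0] with n hn hτn
    have hs := Real.sqrt_pos.2 hτn
    refine ((hmodel n).measure_norm_score_sq_ge_le hn (hZ n) (hB₀ n)
      (s := η * (τ n * √(τ n))) (by positivity)).trans (ENNReal.ofReal_le_ofReal (le_of_eq ?_))
    rw [hcard n]
    have : N n * (c ^ 2 * (Real.exp B * (n : ℝ) ^ (-ξ))) = c ^ 2 * Real.exp B * τ n := by
      simp only [hN, hτ]; ring
    rw [this]
    field_simp
  -- the estimator is close to the normalised score
  set K₀ : ℝ := 2 * (p + 1 : ℕ) / ERC.logisticVarLower B / l with hK₀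
  set K : ℝ := 2 * ((p + 1 : ℕ) * c) ^ 3 * Real.exp ((p + 1 : ℕ) * c) * Real.exp B /
    √(ERC.logisticVarLower B) / √l * K₀ ^ 2 with hK
  have hK_nonneg : 0 ≤ K := by positivity
  set T : Fin p → ∀ n, Ω n → ℝ := fun k n ω => √((n.choose 2 : ℕ) : ℝ) *
    (((θhat n ω).2 k - γ₀ k) / √((Shat n ω)⁻¹ k.succ k.succ)) with hT
  set U : Fin p → ∀ n, Ω n → ℝ := fun k n ω => ∑ e, (ERC.edgeValue (A n e ω) -
    ERC.logisticProb ((n : ℝ) ^ (-ξ))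
      (ERC.augment (Z n e ω) ⬝ᵥ (Fin.cons μ₀ γ₀ : Fin (p + 1) → ℝ))) *
    ERC.influence ((n : ℝ) ^ (-ξ)) (fun e => ERC.augment (Z n e ω)) (Fin.cons μ₀ γ₀) k.succ e
    with hU
  have hbad : ∀ η : ℝ, 0 < η → Tendsto (fun n => P n {ω | ¬ ((Shat n ω).PosDef ∧
      ∀ k, |T k n ω - U k n ω| ≤ K * η)}) atTop (𝓝 0) := by
    intro η hη
    have h1 := hG.add (hS η hη)
    rw [add_zero] at h1
    have h2 : Tendsto (fun n => K₀ ^ 2 * η / √(τ n)) atTop (𝓝 0) :=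
      (Real.tendsto_sqrt_atTop.comp hτtop).const_div_atTop _
    refine tendsto_of_tendsto_of_tendsto_of_le_of_le' tendsto_const_nhds h1
      (Eventually.of_forall fun _ => zero_le) ?_
    filter_upwards [hev, h2.eventually_lt_const (show (0 : ℝ) < r₀ ^ 2 by positivity)]
      with n hn hn2
    refine (measure_mono_ae ?_).trans (measure_union_le _ _)
    filter_upwards [hZ n, hB₀ n, hθhat n] with ω hω1 hω2 hω3 hω4
    by_contra hcon
    have hcon1 : ω ∉ badG n := fun h => hcon (Or.inl h)
    have hcon2 : ¬ η * (τ n * √(τ n)) ≤ ‖sc n ω‖ ^ 2 := fun h => hcon (Or.inr h)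
    have hgood := ERC.studentized_close hξ_nonneg hn hc0 hl hω1 hω2
      (fun e => hpred (hω1 e) hω3.1) (not_not.1 hcon1) hball hr₀ hr₁ hω3.2
      (not_le.1 hcon2).le hn2
    rw [← hShat n ω] at hgood
    exact hω4 hgood
  have hPD : Tendsto (fun n => P n {ω | ¬ (Shat n ω).PosDef}) atTop (𝓝 0) := by
    refine tendsto_of_tendsto_of_tendsto_of_le_of_le tendsto_const_nhds (hbad 1 one_pos)
      (fun _ => zero_le) fun n => measure_mono fun ω hω h => hω h.1
  -- measurability
  have hTm : ∀ k n, AEMeasurable (T k n) (P n) := by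
    intro k n
    have hV : AEMeasurable (fun ω => (Shat n ω)⁻¹ k.succ k.succ) (P n) := by
      simp_rw [hShat]
      exact ERC.aemeasurable_plugInHessian_inv_apply
        (hmodel n).measurable_covariates.aemeasurable (hθhat_meas n) _ _
    have hγ : AEMeasurable (fun ω => (θhat n ω).2 k) (P n) :=
      ((measurable_pi_apply k).comp measurable_snd).comp_aemeasurable (hθhat_meas n)
    exact ((hγ.sub_const _).div hV.sqrt).const_mul _
  have hUm : ∀ k n, AEMeasurable (U k n) (P n) := by
    intro k n
    exact ((hmodel n).measurable_normalizedScore _ _).aemeasurable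
  -- the central limit theorem for the normalised score
  have hchar : ∀ k (t : ℝ), Tendsto (fun n => ∫ ω, Complex.exp ((t * U k n ω : ℝ) * Complex.I)
      ∂(P n)) atTop (𝓝 (Complex.exp ((-t ^ 2 / 2 : ℝ)))) := by
    intro k t
    set κ : ℕ → ℝ := fun n => |t| * ((p + 1 : ℕ) * c /
      √(ERC.logisticVarLower B * ((n : ℝ) ^ (-ξ) * (l * Fintype.card (ERC.Pair n))))) with hκ
    have hκ0 : Tendsto κ atTop (𝓝 0) := by
      have h1 : Tendsto (fun n => ERC.logisticVarLower B * l * τ n) atTop atTop :=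
        hτtop.const_mul_atTop (by positivity)
      have h2 := ((Real.tendsto_sqrt_atTop.comp h1).const_div_atTop ((p + 1 : ℕ) * c)).const_mul |t|
      rw [mul_zero] at h2
      refine h2.congr fun n => ?_
      simp only [hκ, hcard, Function.comp, hτ, hN]
      rw [show ERC.logisticVarLower B * l * ((n : ℝ) ^ (-ξ) * (n.choose 2 : ℕ)) =
        ERC.logisticVarLower B * ((n : ℝ) ^ (-ξ) * (l * (n.choose 2 : ℕ))) by ring]
    have hbound : Tendsto (fun n => 4 * κ n * t ^ 2 + 2 * (P n).real (badG n)) atTop (𝓝 0) := by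
      simpa using ((hκ0.const_mul 4).mul_const (t ^ 2)).add
        ((ERC.tendsto_measureReal_zero hG).const_mul 2)
    rw [tendsto_iff_norm_sub_tendsto_zero]
    refine tendsto_of_tendsto_of_tendsto_of_le_of_le' tendsto_const_nhds hbound
      (Eventually.of_forall fun _ => norm_nonneg _) ?_
    filter_upwards [hev, hκ0.eventually_le_const (show (0 : ℝ) < 1 by norm_num)] with n hn hn1
    have hn0 : 0 < n := Nat.pos_of_ne_zero fun h => by simp [h] at hn
    have hlN : 0 < l * (Fintype.card (ERC.Pair n) : ℝ) := by
      rw [ERC.card_pair]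
      have : (0 : ℝ) < (n.choose 2 : ℕ) := by exact_mod_cast hn
      positivity
    exact (hmodel n).norm_integral_exp_sub_le hξ_nonneg hn0 hlN (hZ n) (hB₀ n) hc0 hn1 k.succ
  have hdist : ∀ k, TendstoInDistribution (T k) atTop (id : ℝ → ℝ) P (gaussianReal 0 1) := fun k => by
    refine ERC.tendstoInDistribution_gaussianReal_of_close hK_nonneg (hTm k) (hUm k)
      (fun η hη _ => ?_) (hchar k)
    exact tendsto_of_tendsto_of_tendsto_of_le_of_le tendsto_const_nhds (hbad η hη)
      (fun _ => zero_le) fun n => measure_mono fun ω hω h => hω (h.2 k)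
  refine ⟨?_, fun k => ⟨hdist k, fun q hq => ?_⟩⟩
  · have h1 : Tendsto (fun n => P n Set.univ) atTop (𝓝 1) := by simp
    refine ERC.tendsto_measure_of_iff_off h1 hPD (Eventually.of_forall fun n ω hω => ?_)
    have : (Shat n ω).PosDef := not_not.1 hω
    exact ⟨fun _ => this, fun _ => Set.mem_univ _⟩
  -- Where `Shat` is positive definite and `n ≥ 2`, clearing square roots turns the coverage event
  -- into `|T| ≤ q`. Division by zero may spoil this for singular `Shat`, which has vanishing
  -- probability.
  · refine ERC.tendsto_measure_of_iff_off
      (ERC.tendsto_measure_abs_le_of_tendstoInDistribution (hdist k) q) hPD ?_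
    filter_upwards [hev] with n hn ω hω
    have hpd : (Shat n ω).PosDef := not_not.1 hω
    have hV := ERC.inv_apply_pos hpd k.succ
    have hNpos : (0 : ℝ) < ((n.choose 2 : ℕ) : ℝ) := by exact_mod_cast hn
    have hsV := Real.sqrt_pos.2 hV
    have hsN := Real.sqrt_pos.2 hNpos
    show |√((n.choose 2 : ℕ) : ℝ) * (((θhat n ω).2 k - γ₀ k) /
        √((Shat n ω)⁻¹ k.succ k.succ))| ≤ q ↔ |(θhat n ω).2 k - γ₀ k| ≤
      q * √((Shat n ω)⁻¹ k.succ k.succ / ((n.choose 2 : ℕ) : ℝ))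
    rw [Real.sqrt_div hV.le, abs_mul, abs_div, abs_of_pos hsV, abs_of_pos hsN, ← mul_div_assoc, ← mul_div_assoc,
      div_le_iff₀ hsV, le_div_iff₀ hsN, mul_comm]
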